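/- **Conventions.** All graded vector spaces are $\mathbb Z$-graded real vector spaces; $|a|$ is the degree of a homogeneous $a$ and $\deg(a)=|a|-1$ its degree in the shifted space $V[1]$. A *Gerstenhaber algebra* $G$ is a graded vector space with an associative graded commutative product of degree $0$ (no unit required) and a bracket of degree $-1$ such that $(G[1],[\,,])$ is a graded Lie algebra and $[a,bc]=[a,b]c+(-1)^{|b|\deg(a)}b[a,c]$. A *$G$-module* $M$ is a graded vector space with an associative product $G\times M\to M$ of degree $0$, $(a,u)\mapsto au$ (and $ua:=(-1)^{|a||u|}au$), and an action $(a,u)\mapsto a\bullet u$ of the graded Lie algebra $G[1]$ on $M[1]$ (so $|a\bullet u|=|a|+|u|-1$), such that $$[a,b]u=a\bullet(bu)-(-1)^{|b|\deg(a)}b(a\bullet u),\qquad (ab)\bullet u=a(b\bullet u)+(-1)^{|a||b|}b(a\bullet u).$$ The semidirect product $G\ltimes M=G\oplus M$ is the Gerstenhaber algebra with $(a+u)(b+v)=ab+av+ub$ and $[a+u,b+v]=[a,b]+a\bullet v-(-1)^{\deg(b)\deg(u)}b\bullet u$. For a Gerstenhaber algebra $B$ let $\mathrm{Bat}(p,q)$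 be the set of permutations of $\{1,\dots,p+q\}$ that are increasing on $\{1,\dots,p\}$ and on $\{p+1,\dots,p+q\}$, and let $\varepsilon$ denote Koszul signs. Let $\mathcal H=\bigoplus_{n\ge1}\underline{\otimes}^nB[1]$, where $\underline\otimes^nB[1]$ is the quotient of $\otimes^nB[1]$ by all shuffle products $$\sum_{\sigma\in \mathrm{Bat}(p,n-p)}\varepsilon_{\deg(a)}(\sigma^{-1})\,a_{\sigma^{-1}(1)}\otimes\cdots\otimes a_{\sigma^{-1}(n)},\qquad 0<p<n.$$ For the class $X$ of $a_1\otimes\cdots\otimes a_p$, its degree in $\mathcal H[1]$ is $\deg(X)=\sum_k\deg(a_k)-1$. Put $$m(X)=\sum_{j=1}^{p-1}(-1)^{\sum_{i\le j}\deg(a_i)}\,\underline{a_1\otimes\cdots\otimes a_ja_{j+1}\otimes\cdots\otimes a_p},$$ and, if $b_1,\dots,b_{p+q}$ are the letters of $X$ followed by the letters of a word $Y$ of length $q$, $$\ell(X,Y)=(-1)^{\deg(X)}\sum_{\sigma\in\mathrm{Bat}(p,q)}\ \sum_{k:\ \sigma^{-1}(k)\le p<\sigma^{-1}(k+1)}\varepsilon_{\deg(b)}(\sigma^{-1})\,\underline{b_{\sigma^{-1}(1)}\otimes\cdots\otimes[b_{\sigma^{-1}(k)},b_{\sigma^{-1}(k+1)}]\otimes\cdots\otimes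 b_{\sigma^{-1}(p+q)}}.$$ Let $G_\infty(B)=\bigoplus_{n\ge1}S^n(\mathcal H[1])$ (graded symmetric powers, inside the graded symmetric algebra with product $\cdot$), and let $C_N(B)\subset G_\infty(B)$ be the span of the products $X_1\cdots X_r$ ($r\ge1$) of classes of nonempty words with $N$ letters in total. **Proposition (expression of the Chevalley–Harrison boundary).** Let $G$ be a Gerstenhaber algebra and $M$ a $G$-module, and take $B=G\ltimes M$. (a) There are unique linear maps $m$, $\ell$ on $S(\mathcal H[1])$ (extended by $0$ to $S^0$) such that, for all words, $$m(X_1\cdots X_n)=\sum_{j}(-1)^{\sum_{k<j}\deg(X_k)}X_1\cdots m(X_j)\cdots X_n,$$ $$\ell(X_1\cdots X_n)=\sum_{i<j}\varepsilon_{\deg(X)}\!\left(\begin{smallmatrix}1\ \dots\ n\\ i,j,1,\dots\hat\imath\dots\hat\jmath\dots,n\end{smallmatrix}\right)\ell(X_i,X_j)\cdot X_1\cdots\hat\imath\cdots\hat\jmath\cdots X_n .$$ The map $m+\ell$ preserves $G_\infty(G\ltimes M)$, $(m+\ell)^2=0$, and $m+\ell$ maps $C_{N+1}(G\ltimes M)$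 into $C_N(G\ltimes M)$ for all $N\ge 0$ (with $C_0(G\ltimes M)=0$). (b) For $N\ge0$ let $C_N(G,M)$ be the span of the products $X_1\cdots X_r\cdot Y$ with $r\ge0$, where the $X_i$ are classes of nonempty words in $G$, $Y=\underline{a_1\otimes\cdots\otimes a_k\otimes v\otimes a_{k+1}\otimes\cdots\otimes a_p}$ with $a_1,\dots,a_p\in G$, $v\in M$, and the total number of letters from $G$ is $N$. Then $C_N(G,M)\subset C_{N+1}(G\ltimes M)$, and these subspaces form a subcomplex of $(G_\infty(G\ltimes M),m+\ell)$: $m+\ell$ maps $C_{N+1}(G,M)$ into $C_N(G,M)$ and vanishes on $C_0(G,M)$. (c) The boundary $\partial=m+\ell$ of this subcomplex is given, for $X_1\cdots X_r\cdot Y$ as in (b), by $$\begin{aligned}\partial(X_1\cdots X_r\cdot Y)={}&(\ell+m)(X_1\cdots X_r)\cdot Y+(-1)^{\sum_i\deg(X_i)}X_1\cdots X_r\cdot m(Y)\\&+\sum_i(-1)^{\sum_{j\ne i}\deg(X_j)}\,\varepsilon_{\deg(X)}\!\left(\begin{smallmatrix}1,\dots,r\\ 1,\dots\hat\imath\dots,r,i\end{smallmatrix}\right)X_1\cdots\hat\imath\cdots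 X_r\cdot\ell(X_i,Y).\end{aligned}$$ -/

import Mathlib

noncomputable section

/-! Graded real vector spaces are given by a family of submodules `𝒱 i`, `i : ℤ`, of a real vector
space with `DirectSum.IsInternal 𝒱`.  For `a ∈ 𝒱 i` we write `|a| = i` and `deg a = i - 1`
(the degree of `a` in `V[1]`). -/

section Graded

variable {V W N : Type*} [AddCommGroup V] [Module ℝ V] [AddCommGroup W] [Module ℝ W]
  [AddCommGroup N] [Module ℝ N]

/-- The linear map on an internally graded space with prescribed restrictions to the pieces. -/
def gradedLift {𝒱 : ℤ → Submodule ℝ V} (h : DirectSum.IsInternal 𝒱) (φ : ∀ i, 𝒱 i →ₗ[ℝ] N) :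
    V →ₗ[ℝ] N :=
  (DirectSum.toModule ℝ ℤ N φ).comp
    (LinearEquiv.ofBijective (DirectSum.coeLinearMap 𝒱) h).symm.toLinearMap

theorem gradedLift_of_mem {𝒱 : ℤ → Submodule ℝ V} (h : DirectSum.IsInternal 𝒱)
    (φ : ∀ i, 𝒱 i →ₗ[ℝ] N) {i : ℤ} {a : V} (ha : a ∈ 𝒱 i) : gradedLift h φ a = φ i ⟨a, ha⟩ := by
  have key : (LinearEquiv.ofBijective (DirectSum.coeLinearMap 𝒱) h).symm a
      = DirectSum.lof ℝ ℤ (fun i => 𝒱 i) i ⟨a, ha⟩ := by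
    rw [LinearEquiv.symm_apply_eq]
    exact (DirectSum.coeLinearMap_lof 𝒱 i ⟨a, ha⟩).symm
  simp [gradedLift, key]

/-- The flip `b, a ↦ (-1)^((|a| - s) * (|b| - s)) f a b` of a bilinear map, following the sign rule
for degrees shifted by `s`. -/
def gradedFlip {𝒱 : ℤ → Submodule ℝ V} (hV : DirectSum.IsInternal 𝒱)
    {𝒲 : ℤ → Submodule ℝ W} (hW : DirectSum.IsInternal 𝒲) (s : ℤ) (f : V →ₗ[ℝ] W →ₗ[ℝ] N) :
    W →ₗ[ℝ] V →ₗ[ℝ] N :=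
  gradedLift hW fun j => LinearMap.flip
    (gradedLift hV fun i =>
      ((-1 : ℝ) ^ ((i - s) * (j - s))) • ((f.domRestrict (𝒱 i)).compl₂ (𝒲 j).subtype))

theorem gradedFlip_of_mem {𝒱 : ℤ → Submodule ℝ V} (hV : DirectSum.IsInternal 𝒱)
    {𝒲 : ℤ → Submodule ℝ W} (hW : DirectSum.IsInternal 𝒲) (s : ℤ) (f : V →ₗ[ℝ] W →ₗ[ℝ] N)
    {i j : ℤ} {a : V} {b : W} (ha : a ∈ 𝒱 i) (hb : b ∈ 𝒲 j) :
    gradedFlip hV hW s f b a = ((-1 : ℝ) ^ ((i - s) * (j - s))) • f a b := by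
  rw [gradedFlip, gradedLift_of_mem hW _ hb, LinearMap.flip_apply, gradedLift_of_mem hV _ ha]
  simp

theorem isInternal_prod {𝒱 : ℤ → Submodule ℝ V} (hV : DirectSum.IsInternal 𝒱)
    {𝒲 : ℤ → Submodule ℝ W} (hW : DirectSum.IsInternal 𝒲) :
    DirectSum.IsInternal fun i => (𝒱 i).prod (𝒲 i) := by
  rw [DirectSum.isInternal_submodule_iff_iSupIndep_and_iSup_eq_top] at *
  constructor
  · intro i
    have hle : (⨆ j, ⨆ (_ : j ≠ i), (𝒱 j).prod (𝒲 j)) ≤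
        (⨆ j, ⨆ (_ : j ≠ i), 𝒱 j).prod (⨆ j, ⨆ (_ : j ≠ i), 𝒲 j) :=
      iSup₂_le fun j hj => Submodule.prod_mono (le_iSup₂_of_le j hj le_rfl)
        (le_iSup₂_of_le j hj le_rfl)
    refine Disjoint.mono_right hle ?_
    rw [Submodule.disjoint_def]
    rintro ⟨a, b⟩ ⟨h1, h2⟩ ⟨h3, h4⟩
    exact Prod.ext (Submodule.disjoint_def.1 (hV.1 i) a h1 h3)
      (Submodule.disjoint_def.1 (hW.1 i) b h2 h4)
  · rw [eq_top_iff]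
    rintro ⟨a, b⟩ -
    have h1 : Submodule.map (LinearMap.inl ℝ V W) (⨆ i, 𝒱 i) ≤ ⨆ i, (𝒱 i).prod (𝒲 i) := by
      rw [Submodule.map_iSup]
      refine iSup_mono fun i => ?_
      rintro _ ⟨x, hx, rfl⟩
      exact ⟨hx, Submodule.zero_mem _⟩
    have h2 : Submodule.map (LinearMap.inr ℝ V W) (⨆ i, 𝒲 i) ≤ ⨆ i, (𝒱 i).prod (𝒲 i) := by
      rw [Submodule.map_iSup]
      refine iSup_mono fun i => ?_
      rintro _ ⟨x, hx, rfl⟩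
      exact ⟨Submodule.zero_mem _, hx⟩
    have e : ((a, b) : V × W) = LinearMap.inl ℝ V W a + LinearMap.inr ℝ V W b := by simp
    rw [e]
    exact Submodule.add_mem _ (h1 ⟨a, by simp [hV.2], rfl⟩) (h2 ⟨b, by simp [hW.2], rfl⟩)

end Graded

/-- A Gerstenhaber algebra: an associative graded commutative product of degree `0` (no unit is
required) and a bracket of degree `-1` which is a graded Lie bracket on `G[1]` and satisfies the
graded Leibniz rule. -/
structure GerstenhaberAlgebra (G : Type*) [AddCommGroup G] [Module ℝ G] where
  grade : ℤ → Submodule ℝ G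
  isInternal : DirectSum.IsInternal grade
  mul : G →ₗ[ℝ] G →ₗ[ℝ] G
  bracket : G →ₗ[ℝ] G →ₗ[ℝ] G
  mul_mem : ∀ {i j : ℤ} {a b : G}, a ∈ grade i → b ∈ grade j → mul a b ∈ grade (i + j)
  bracket_mem : ∀ {i j : ℤ} {a b : G}, a ∈ grade i → b ∈ grade j →
    bracket a b ∈ grade (i + j - 1)
  mul_comm : ∀ {i j : ℤ} {a b : G}, a ∈ grade i → b ∈ grade j →
    mul a b = ((-1 : ℝ) ^ (i * j)) • mul b a
  mul_assoc : ∀ {i j k : ℤ} {a b c : G}, a ∈ grade i → b ∈ grade j → c ∈ grade k →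
    mul (mul a b) c = mul a (mul b c)
  antisymm : ∀ {i j : ℤ} {a b : G}, a ∈ grade i → b ∈ grade j →
    bracket a b = -(((-1 : ℝ) ^ ((i - 1) * (j - 1))) • bracket b a)
  jacobi : ∀ {i j k : ℤ} {a b c : G}, a ∈ grade i → b ∈ grade j → c ∈ grade k →
    ((-1 : ℝ) ^ ((i - 1) * (k - 1))) • bracket (bracket a b) c
      + ((-1 : ℝ) ^ ((j - 1) * (i - 1))) • bracket (bracket b c) a
      + ((-1 : ℝ) ^ ((k - 1) * (j - 1))) • bracket (bracket c a) b = 0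
  leibniz : ∀ {i j k : ℤ} {a b c : G}, a ∈ grade i → b ∈ grade j → c ∈ grade k →
    bracket a (mul b c) = mul (bracket a b) c + ((-1 : ℝ) ^ (j * (i - 1))) • mul b (bracket a c)

/-- A module over a Gerstenhaber algebra: a graded vector space with a product `smul a u = a u`
(the right product being `u a = (-1)^(|a||u|) a u`), making it a symmetric bimodule over the
commutative algebra `G`, and an action `act a u` of the graded Lie algebra `G[1]` on `M[1]`,
with the two Leibniz compatibilities. -/
structure GerstenhaberModule {G : Type*} [AddCommGroup G] [Module ℝ G]
    (A : GerstenhaberAlgebra G) (M : Type*) [AddCommGroup M] [Module ℝ M] where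
  grade : ℤ → Submodule ℝ M
  isInternal : DirectSum.IsInternal grade
  smul : G →ₗ[ℝ] M →ₗ[ℝ] M
  act : G →ₗ[ℝ] M →ₗ[ℝ] M
  smul_mem : ∀ {i j : ℤ} {a : G} {u : M}, a ∈ A.grade i → u ∈ grade j → smul a u ∈ grade (i + j)
  act_mem : ∀ {i j : ℤ} {a : G} {u : M}, a ∈ A.grade i → u ∈ grade j →
    act a u ∈ grade (i + j - 1)
  mul_smul : ∀ {i j k : ℤ} {a b : G} {u : M}, a ∈ A.grade i → b ∈ A.grade j → u ∈ grade k →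
    smul (A.mul a b) u = smul a (smul b u)
  bracket_act : ∀ {i j k : ℤ} {a b : G} {u : M}, a ∈ A.grade i → b ∈ A.grade j → u ∈ grade k →
    act (A.bracket a b) u = act a (act b u) - ((-1 : ℝ) ^ ((i - 1) * (j - 1))) • act b (act a u)
  bracket_smul : ∀ {i j k : ℤ} {a b : G} {u : M}, a ∈ A.grade i → b ∈ A.grade j → u ∈ grade k →
    smul (A.bracket a b) u = act a (smul b u) - ((-1 : ℝ) ^ (j * (i - 1))) • smul b (act a u)
  mul_act : ∀ {i j k : ℤ} {a b : G} {u : M}, a ∈ A.grade i → b ∈ A.grade j → u ∈ grade k →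
    act (A.mul a b) u = smul a (act b u) + ((-1 : ℝ) ^ (i * j)) • smul b (act a u)

namespace GerstenhaberModule

variable {G M : Type*} [AddCommGroup G] [Module ℝ G] [AddCommGroup M] [Module ℝ M]
  {A : GerstenhaberAlgebra G} (P : GerstenhaberModule A M)

/-- `(a + u)(b + v) = ab + av + ub`, with `u b = (-1)^(|b||u|) b u`. -/
def sdMul : G × M →ₗ[ℝ] G × M →ₗ[ℝ] G × M :=
  LinearMap.mk₂ ℝ
    (fun x y => (A.mul x.1 y.1, P.smul x.1 y.2 + gradedFlip A.isInternal P.isInternal 0 P.smul x.2 y.1))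
    (by intros; ext <;> simp; abel) (by intros; ext <;> simp)
    (by intros; ext <;> simp; abel) (by intros; ext <;> simp)

/-- `[a + u, b + v] = [a, b] + a • v - (-1)^(deg b * deg u) b • u`. -/
def sdBracket : G × M →ₗ[ℝ] G × M →ₗ[ℝ] G × M :=
  LinearMap.mk₂ ℝ
    (fun x y => (A.bracket x.1 y.1, P.act x.1 y.2 - gradedFlip A.isInternal P.isInternal 1 P.act x.2 y.1))
    (by intros; ext <;> simp; abel) (by intros; ext <;> simp [smul_sub])
    (by intros; ext <;> simp; abel) (by intros; ext <;> simp [smul_sub])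

theorem sdMul_apply (x y : G × M) : P.sdMul x y = (A.mul x.1 y.1,
    P.smul x.1 y.2 + gradedFlip A.isInternal P.isInternal 0 P.smul x.2 y.1) := rfl

theorem sdBracket_apply (x y : G × M) : P.sdBracket x y = (A.bracket x.1 y.1,
    P.act x.1 y.2 - gradedFlip A.isInternal P.isInternal 1 P.act x.2 y.1) := rfl

theorem neg_one_zpow_eq (n : ℤ) : (-1 : ℝ) ^ n = if Even n then 1 else -1 := by
  split_ifs with h
  · exact h.neg_one_zpow
  · exact (Int.not_even_iff_odd.1 h).neg_one_zpow

/-- The semidirect product `G ⋉ M`, as a Gerstenhaber algebra. -/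
def semidirect : GerstenhaberAlgebra (G × M) where
  grade := fun i => (A.grade i).prod (P.grade i)
  isInternal := isInternal_prod A.isInternal P.isInternal
  mul := P.sdMul
  bracket := P.sdBracket
  mul_mem := by
    rintro i j ⟨a, u⟩ ⟨b, v⟩ ⟨ha, hu⟩ ⟨hb, hv⟩
    refine ⟨A.mul_mem ha hb, ?_⟩
    simp only [sdMul_apply, gradedFlip_of_mem A.isInternal P.isInternal _ _ hb hu]
    refine Submodule.add_mem _ (P.smul_mem ha hv) (Submodule.smul_mem _ _ ?_)
    rw [add_comm i j]
    exact P.smul_mem hb hu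
  bracket_mem := by
    rintro i j ⟨a, u⟩ ⟨b, v⟩ ⟨ha, hu⟩ ⟨hb, hv⟩
    refine ⟨A.bracket_mem ha hb, ?_⟩
    simp only [sdBracket_apply, gradedFlip_of_mem A.isInternal P.isInternal _ _ hb hu]
    refine Submodule.sub_mem _ (P.act_mem ha hv) (Submodule.smul_mem _ _ ?_)
    rw [add_comm i j]
    exact P.act_mem hb hu
  mul_comm := by
    rintro i j ⟨a, u⟩ ⟨b, v⟩ ⟨ha, hu⟩ ⟨hb, hv⟩
    simp only [sdMul_apply, gradedFlip_of_mem A.isInternal P.isInternal _ _ hb hu,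
      gradedFlip_of_mem A.isInternal P.isInternal _ _ ha hv]
    refine Prod.ext (A.mul_comm ha hb) ?_
    by_cases hi : Even i <;> by_cases hj : Even j <;>
      simp [neg_one_zpow_eq, Int.even_mul, hi, hj, add_comm]
  mul_assoc := by
    rintro i j k ⟨a, u⟩ ⟨b, v⟩ ⟨c, w⟩ ⟨ha, hu⟩ ⟨hb, hv⟩ ⟨hc, hw⟩
    have e1 := P.mul_smul ha hb hw
    have e2 : P.smul c (P.smul a v) = ((-1 : ℝ) ^ (k * i)) • P.smul a (P.smul c v) := by
      rw [← P.mul_smul hc ha hv, ← P.mul_smul ha hc hv, A.mul_comm hc ha, map_smul,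
        LinearMap.smul_apply]
    have e3 : P.smul (A.mul b c) u = ((-1 : ℝ) ^ (j * k)) • P.smul c (P.smul b u) := by
      rw [A.mul_comm hb hc, map_smul, LinearMap.smul_apply, P.mul_smul hc hb hu]
    refine Prod.ext (A.mul_assoc ha hb hc) ?_
    simp only [sdMul_apply, gradedFlip_of_mem A.isInternal P.isInternal _ _ hb hu,
      gradedFlip_of_mem A.isInternal P.isInternal _ _ hc hv, map_add, map_smul,
      LinearMap.add_apply, LinearMap.smul_apply,
      gradedFlip_of_mem A.isInternal P.isInternal _ _ hc (P.smul_mem ha hv),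
      gradedFlip_of_mem A.isInternal P.isInternal _ _ hc (P.smul_mem hb hu),
      gradedFlip_of_mem A.isInternal P.isInternal _ _ (A.mul_mem hb hc) hu, e1, e2, e3]
    by_cases hi : Even i <;> by_cases hj : Even j <;> by_cases hk : Even k <;>
      simp only [neg_one_zpow_eq, Int.even_mul, Int.even_sub, Int.even_add, Int.not_even_one,
        sub_zero, hi, hj, hk, iff_true, iff_false, not_true_eq_false, not_false_eq_true, or_true,
        or_false, true_or, or_self, if_true, if_false] <;> module
  antisymm := by
    rintro i j ⟨a, u⟩ ⟨b, v⟩ ⟨ha, hu⟩ ⟨hb, hv⟩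
    simp only [sdBracket_apply, gradedFlip_of_mem A.isInternal P.isInternal _ _ hb hu,
      gradedFlip_of_mem A.isInternal P.isInternal _ _ ha hv]
    refine Prod.ext (A.antisymm ha hb) ?_
    by_cases hi : Even i <;> by_cases hj : Even j <;>
      simp only [neg_one_zpow_eq, sub_zero, Int.even_mul, Int.even_sub, Int.not_even_one, hi, hj, iff_true,
        iff_false, not_true_eq_false, not_false_eq_true, or_true, or_false, true_or, or_self,
        if_true, if_false, Prod.snd_neg, Prod.smul_snd] <;> module
  jacobi := by
    rintro i j k ⟨a, u⟩ ⟨b, v⟩ ⟨c, w⟩ ⟨ha, hu⟩ ⟨hb, hv⟩ ⟨hc, hw⟩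
    have e1 := P.bracket_act ha hb hw
    have e2 := P.bracket_act hb hc hu
    have e3 := P.bracket_act hc ha hv
    refine Prod.ext (A.jacobi ha hb hc) ?_
    simp only [sdBracket_apply, gradedFlip_of_mem A.isInternal P.isInternal _ _ hb hu,
      gradedFlip_of_mem A.isInternal P.isInternal _ _ hc hv,
      gradedFlip_of_mem A.isInternal P.isInternal _ _ ha hw, map_sub, map_smul,
      LinearMap.sub_apply, LinearMap.smul_apply,
      gradedFlip_of_mem A.isInternal P.isInternal _ _ hc (P.act_mem ha hv),
      gradedFlip_of_mem A.isInternal P.isInternal _ _ hc (P.act_mem hb hu),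
      gradedFlip_of_mem A.isInternal P.isInternal _ _ ha (P.act_mem hb hw),
      gradedFlip_of_mem A.isInternal P.isInternal _ _ ha (P.act_mem hc hv),
      gradedFlip_of_mem A.isInternal P.isInternal _ _ hb (P.act_mem hc hu),
      gradedFlip_of_mem A.isInternal P.isInternal _ _ hb (P.act_mem ha hw), e1, e2, e3,
      Prod.snd_add, Prod.smul_snd, Prod.snd_zero]
    by_cases hi : Even i <;> by_cases hj : Even j <;> by_cases hk : Even k <;>
      simp only [neg_one_zpow_eq, Int.even_mul, Int.even_sub, Int.even_add, Int.not_even_one,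
        sub_zero, hi, hj, hk, iff_true, iff_false, not_true_eq_false, not_false_eq_true, or_true,
        or_false, true_or, or_self, if_true, if_false] <;> module
  leibniz := by
    rintro i j k ⟨a, u⟩ ⟨b, v⟩ ⟨c, w⟩ ⟨ha, hu⟩ ⟨hb, hv⟩ ⟨hc, hw⟩
    have e1 := P.bracket_smul ha hb hw
    have e2 := P.bracket_smul ha hc hv
    have e3 := P.mul_act hb hc hu
    refine Prod.ext (A.leibniz ha hb hc) ?_
    simp only [sdMul_apply, sdBracket_apply,
      gradedFlip_of_mem A.isInternal P.isInternal _ _ hb hu,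
      gradedFlip_of_mem A.isInternal P.isInternal _ _ hc hv,
      gradedFlip_of_mem A.isInternal P.isInternal _ _ hc hu, map_add, map_sub, map_smul,
      LinearMap.add_apply, LinearMap.sub_apply, LinearMap.smul_apply,
      gradedFlip_of_mem A.isInternal P.isInternal _ _ hc (P.act_mem ha hv),
      gradedFlip_of_mem A.isInternal P.isInternal _ _ hc (P.act_mem hb hu),
      gradedFlip_of_mem A.isInternal P.isInternal _ _ (A.bracket_mem ha hc) hv,
      gradedFlip_of_mem A.isInternal P.isInternal _ _ (A.mul_mem hb hc) hu, e1, e2, e3,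
      Prod.snd_add, Prod.smul_snd]
    by_cases hi : Even i <;> by_cases hj : Even j <;> by_cases hk : Even k <;>
      simp only [neg_one_zpow_eq, Int.even_mul, Int.even_sub, Int.even_add, Int.not_even_one,
        sub_zero, hi, hj, hk, iff_true, iff_false, not_true_eq_false, not_false_eq_true, or_true,
        or_false, true_or, or_self, if_true, if_false] <;> module

end GerstenhaberModule

section Words

variable {V : Type*} [AddCommGroup V] [Module ℝ V] (𝒱 : ℤ → Submodule ℝ V)

/-- A homogeneous element together with its degree. -/
abbrev Letter := Σ i : ℤ, 𝒱 i

variable {𝒱}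

/-- `deg a = |a| - 1`. -/
def letterDeg (a : Letter 𝒱) : ℤ := a.1 - 1

/-- The degree in `𝓗[1]` of the word `a₁ ⊗ ⋯ ⊗ a_p`, namely `deg a₁ + ⋯ + deg a_p - 1`. -/
def wordDeg (w : List (Letter 𝒱)) : ℤ := (w.map letterDeg).sum - 1

/-- The tensor `a₁ ⊗ ⋯ ⊗ a_p`. -/
def tens (w : List (Letter 𝒱)) : TensorAlgebra ℝ V :=
  (w.map fun a => TensorAlgebra.ι ℝ (a.2 : V)).prod

/-- The word `b_{σ⁻¹(1)}, …, b_{σ⁻¹(n)}`. -/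
def permuteWord (b : List (Letter 𝒱)) (σ : Equiv.Perm (Fin b.length)) : List (Letter 𝒱) :=
  List.ofFn fun k => b.get (σ⁻¹ k)

/-- The Koszul sign `ε_{deg b}(σ⁻¹)` of the passage from `b₁, …, b_n` to
`b_{σ⁻¹(1)}, …, b_{σ⁻¹(n)}`: a factor `(-1)^(deg b_i * deg b_j)` for each pair that gets
interchanged. -/
def koszulSign (b : List (Letter 𝒱)) (σ : Equiv.Perm (Fin b.length)) : ℝ :=
  ∏ i, ∏ j, if i < j ∧ σ j < σ i then
    (-1 : ℝ) ^ (letterDeg (b.get i) * letterDeg (b.get j)) else 1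

/-- `Bat(p, n - p)`: permutations increasing on the first `p` indices and on the other ones. -/
def shuffles (p n : ℕ) : Finset (Equiv.Perm (Fin n)) :=
  Finset.univ.filter fun σ => ∀ i j : Fin n, i < j → ((j : ℕ) < p ∨ p ≤ (i : ℕ)) → σ i < σ j

/-- The shuffle product `bat_{p,q}(x, y)` of two words, with respect to the degrees `deg`. -/
def shuffleProd (x y : List (Letter 𝒱)) : TensorAlgebra ℝ V :=
  ∑ σ ∈ shuffles x.length (x ++ y).length,
    koszulSign (x ++ y) σ • tens (permuteWord (x ++ y) σ)

variable (𝒱)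

/-- The subspace of the tensor algebra spanned by the scalars (so that only tensors of length
`≥ 1` remain in the quotient) and by the shuffle products of nonempty words. -/
def shuffleRel : Submodule ℝ (TensorAlgebra ℝ V) :=
  Submodule.span ℝ ({1} ∪ {t | ∃ x y : List (Letter 𝒱), x ≠ [] ∧ y ≠ [] ∧ t = shuffleProd x y})

/-- `𝓗 = ⨁_{n ≥ 1} ⊗ⁿ V[1] / (shuffles)`. -/
abbrev ShuffleQuot := TensorAlgebra ℝ V ⧸ shuffleRel 𝒱

/-- The relations `X · Y = (-1)^(deg X * deg Y) Y · X` of graded commutativity on `𝓗[1]`. -/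
def symRel (s t : TensorAlgebra ℝ (ShuffleQuot 𝒱)) : Prop :=
  ∃ x y : List (Letter 𝒱),
    s = TensorAlgebra.ι ℝ ((shuffleRel 𝒱).mkQ (tens x)) *
        TensorAlgebra.ι ℝ ((shuffleRel 𝒱).mkQ (tens y)) ∧
    t = ((-1 : ℝ) ^ (wordDeg x * wordDeg y)) •
        (TensorAlgebra.ι ℝ ((shuffleRel 𝒱).mkQ (tens y)) *
        TensorAlgebra.ι ℝ ((shuffleRel 𝒱).mkQ (tens x)))

/-- The graded symmetric algebra `S(𝓗[1]) = ⨁_{n ≥ 0} Sⁿ(𝓗[1])`. -/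
abbrev SymH := RingQuot (symRel 𝒱)

/-- The projection of a tensor to `𝓗[1] = S¹(𝓗[1])`. -/
def proj : TensorAlgebra ℝ V →ₗ[ℝ] SymH 𝒱 :=
  (RingQuot.mkAlgHom ℝ (symRel 𝒱)).toLinearMap ∘ₗ TensorAlgebra.ι ℝ ∘ₗ (shuffleRel 𝒱).mkQ

variable {𝒱}

/-- The product `X₁ · ⋯ · X_n` in `S(𝓗[1])` of the classes of the words `X₁, …, X_n`. -/
def symProd (X : List (List (Letter 𝒱))) : SymH 𝒱 := (X.map fun x => proj 𝒱 (tens x)).prod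

end Words

namespace GerstenhaberAlgebra

variable {G : Type*} [AddCommGroup G] [Module ℝ G] (A : GerstenhaberAlgebra G)

/-- `m(a₁ ⊗ ⋯ ⊗ a_n) = ∑_j (-1)^(∑_{i<j} deg a_i) a₁ ⊗ ⋯ ⊗ m(a_j ⊗ a_{j+1}) ⊗ ⋯ ⊗ a_n`,
where `m(a ⊗ b) = (-1)^(deg a) a b`; the two signs are combined. -/
def mulTens (w : List (Letter A.grade)) : TensorAlgebra ℝ G :=
  ∑ j : Fin w.length, ∑ j' : Fin w.length,
    if (j' : ℕ) = j + 1 then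
      ((-1 : ℝ) ^ ((w.take (j + 1)).map letterDeg).sum) •
        (tens (w.take j) * TensorAlgebra.ι ℝ (A.mul (w.get j).2 (w.get j').2) *
          tens (w.drop (j + 2)))
    else 0

/-- `[x ∧ y]`: with `b₁, …, b_{p+q}` the letters of `x` followed by those of `y`, the sum over
`σ ∈ Bat(p, q)` and over `k` with `σ⁻¹(k) ≤ p < σ⁻¹(k+1)` of
`ε(σ⁻¹) b_{σ⁻¹(1)} ⊗ ⋯ ⊗ [b_{σ⁻¹(k)}, b_{σ⁻¹(k+1)}] ⊗ ⋯ ⊗ b_{σ⁻¹(p+q)}`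
(the indices in the code start from `0`). -/
def bracketTens (x y : List (Letter A.grade)) : TensorAlgebra ℝ G :=
  ∑ σ ∈ shuffles x.length (x ++ y).length,
    ∑ k : Fin (x ++ y).length, ∑ k' : Fin (x ++ y).length,
      if (k' : ℕ) = k + 1 ∧ ((σ⁻¹ k : Fin _) : ℕ) < x.length ∧
          x.length ≤ ((σ⁻¹ k' : Fin _) : ℕ) then
        koszulSign (x ++ y) σ •
          (tens ((permuteWord (x ++ y) σ).take k) *
            TensorAlgebra.ι ℝ (A.bracket ((x ++ y).get (σ⁻¹ k)).2 ((x ++ y).get (σ⁻¹ k')).2) *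
            tens ((permuteWord (x ++ y) σ).drop (k + 2)))
      else 0

/-- The class in `𝓗[1]` of `m(X)`. -/
def mBlock (x : List (Letter A.grade)) : SymH A.grade := proj A.grade (A.mulTens x)

/-- `ℓ(X, Y) = (-1)^(deg X) [X ∧ Y]` in `𝓗[1]`. -/
def lBlock (x y : List (Letter A.grade)) : SymH A.grade :=
  ((-1 : ℝ) ^ wordDeg x) • proj A.grade (A.bracketTens x y)

/-- The positive part `⨁_{n ≥ 1} Sⁿ(𝓗[1])`, the underlying space of `G_∞(G)`. -/
def gInf : Submodule ℝ (SymH A.grade) :=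
  Submodule.span ℝ {z | ∃ X : List (List (Letter A.grade)), X ≠ [] ∧ z = symProd X}

/-- `C_N(G)`: the span of the products `X₁ · ⋯ · X_r`, `r ≥ 1`, of nonempty words with `N` letters
in total. -/
def chains (N : ℕ) : Submodule ℝ (SymH A.grade) :=
  Submodule.span ℝ {z | ∃ X : List (List (Letter A.grade)),
    X ≠ [] ∧ (∀ x ∈ X, x ≠ []) ∧ (X.map List.length).sum = N ∧ z = symProd X}

/-- `m` is the extension of the product to `S(𝓗[1])`:
`m(X₁ · ⋯ · X_n) = ∑_j (-1)^(∑_{k<j} deg X_k) X₁ · ⋯ · m(X_j) · ⋯ · X_n`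
(for `n = 0` this says `m(1) = 0`). -/
def IsProductExtension (m : SymH A.grade →ₗ[ℝ] SymH A.grade) : Prop :=
  ∀ X : List (List (Letter A.grade)),
    m (symProd X) = ∑ j : Fin X.length,
      ((-1 : ℝ) ^ ((X.take j).map wordDeg).sum) •
        (symProd (X.take j) * A.mBlock (X.get j) * symProd (X.drop (j + 1)))

/-- `ℓ` is the extension of the bracket to `S(𝓗[1])`:
`ℓ(X₁ · ⋯ · X_n) = ∑_{i<j} ε(1 ⋯ n; i, j, 1 ⋯ î ⋯ ĵ ⋯ n) ℓ(X_i, X_j) · X₁ ⋯ X̂_i ⋯ X̂_j ⋯ X_n`.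
The Koszul sign comes from moving `X_i` to the left of the `X_k` with `k < i`, then `X_j` to the
left of the `X_k` with `k < j`, `k ≠ i`. -/
def IsBracketExtension (l : SymH A.grade →ₗ[ℝ] SymH A.grade) : Prop :=
  ∀ X : List (List (Letter A.grade)),
    l (symProd X) = ∑ i : Fin X.length, ∑ j : Fin X.length,
      if i < j then
        ((-1 : ℝ) ^ (wordDeg (X.get i) * ((X.take i).map wordDeg).sum
            + wordDeg (X.get j) * (((X.take j).eraseIdx i).map wordDeg).sum)) •
          (A.lBlock (X.get i) (X.get j) * symProd ((X.eraseIdx j).eraseIdx i))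
      else 0

end GerstenhaberAlgebra

namespace GerstenhaberModule

variable {G M : Type*} [AddCommGroup G] [Module ℝ G] [AddCommGroup M] [Module ℝ M]
  {A : GerstenhaberAlgebra G} (P : GerstenhaberModule A M)

/-- A homogeneous element of `G`, seen in `G ⋉ M`. -/
def inG (a : Letter A.grade) : Letter P.semidirect.grade :=
  ⟨a.1, ⟨((a.2 : G), 0), ⟨a.2.2, Submodule.zero_mem _⟩⟩⟩

/-- A homogeneous element of `M`, seen in `G ⋉ M`. -/
def inM (v : Letter P.grade) : Letter P.semidirect.grade :=
  ⟨v.1, ⟨(0, (v.2 : M)), ⟨Submodule.zero_mem _, v.2.2⟩⟩⟩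

/-- A word in `G`, seen as a word in `G ⋉ M`. -/
def gWord (x : List (Letter A.grade)) : List (Letter P.semidirect.grade) := x.map P.inG

/-- The word `a₁ ⊗ ⋯ ⊗ a_k ⊗ v ⊗ a_{k+1} ⊗ ⋯ ⊗ a_p` in `G ⋉ M`. -/
def mWord (y : List (Letter A.grade)) (v : Letter P.grade) (y' : List (Letter A.grade)) :
    List (Letter P.semidirect.grade) := P.gWord y ++ P.inM v :: P.gWord y'

/-- `C_N(G, M)`: the span of the products `X₁ · ⋯ · X_r · Y`, `r ≥ 0`, where the `X_i` are nonempty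
words in `G`, `Y` is a word with one letter in `M` and the others in `G`, and the total number of
letters in `G` is `N`. -/
def moduleChains (N : ℕ) : Submodule ℝ (SymH P.semidirect.grade) :=
  Submodule.span ℝ {z | ∃ (X : List (List (Letter A.grade))) (y : List (Letter A.grade))
    (v : Letter P.grade) (y' : List (Letter A.grade)),
    (∀ x ∈ X, x ≠ []) ∧ (X.map List.length).sum + (y.length + y'.length) = N ∧
    z = symProd (X.map P.gWord) * symProd [P.mWord y v y']}

end GerstenhaberModule

end

/-!
On tensors, the shuffle products, `m` and the bracket `ℓ(X, ·)` obey recursions on the first letter.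
By these recursions `m` and `ℓ` descend modulo shuffles, and on `𝓗[1]` the identity `m² = 0`, the
Leibniz rule and the Jacobi identity reduce to the axioms of a Gerstenhaber algebra.  On
`S(𝓗[1])` the map `m` is a graded derivation, and `ℓ` is determined by
`ℓ(X · s) = ad_X s + (-1)^(deg X) X · ℓ(s)`, where `ad_X` is the graded derivation extending
`ℓ(X, ·)`.  Hence `m² = 0`, `mℓ + ℓm = 0` and `ℓ² = 0` follow from the identities on `𝓗[1]` by
induction on the number of factors.

For `G ⋉ M`, both operators lower the number of letters by one and preserve the number of letters
from `M`, so the products with exactly one letter from `M` span a subcomplex.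
-/

noncomputable section

section KoszulSign

/-- The sign `(-1)^(i * j)` of the exchange of two elements of degrees `i` and `j`.  It is a
symmetric bicharacter with values in `{1, -1}`, and all sign computations rest on that alone. -/
def koszul (i j : ℤ) : ℝ := (-1) ^ (i * j)

variable (i j k : ℤ)

@[grind! .] theorem koszul_comm : koszul i j = koszul j i := by rw [koszul, koszul, mul_comm]

@[grind =] theorem koszul_add_left : koszul (i + j) k = koszul i k * koszul j k := by
  rw [koszul, add_mul, zpow_add₀ (by norm_num), koszul, koszul]

@[grind =] theorem koszul_add_right : koszul i (j + k) = koszul i j * koszul i k := by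
  rw [koszul_comm, koszul_add_left, koszul_comm j, koszul_comm k]

@[grind! .] theorem koszul_mul_self : koszul i j * koszul i j = 1 := by
  rw [koszul, ← mul_zpow, neg_one_mul, neg_neg, one_zpow]

@[simp] theorem koszul_zero_left : koszul 0 j = 1 := by simp [koszul]

@[simp] theorem koszul_zero_right : koszul i 0 = 1 := by simp [koszul]

@[simp, grind =] theorem koszul_one_one : koszul 1 1 = -1 := by simp [koszul]

theorem koszul_one_left : koszul 1 j = (-1) ^ j := by rw [koszul, one_mul]

end KoszulSign

section Generation

theorem span_range_prod_map_eq_top {R S ι : Type*} [CommRing R] [Ring S] [Algebra R S] {f : ι → S}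
    (hf : Algebra.adjoin R (Set.range f) = ⊤) :
    Submodule.span R (Set.range fun l : List ι => (l.map f).prod) = ⊤ := by
  have hrange : (Set.range fun l : List ι => (l.map f).prod) =
      Submonoid.closure (Set.range f) := by
    rw [← FreeMonoid.mrange_lift, MonoidHom.coe_mrange]
    exact congrArg Set.range (funext fun l => (FreeMonoid.lift_apply f l).symm)
  rw [hrange, ← Algebra.adjoin_eq_span, hf, Algebra.top_toSubmodule]

variable {R S V N : Type*} [CommRing R] [Ring S] [Algebra R S] [AddCommGroup V] [Module R V]
  [AddCommGroup N] [Module R N]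

/-- One step of a recursion over the products of elements `j v` of an algebra, acting on the pairs
of an element of the algebra and the value of the recursion on it. -/
def recStep (j : V →ₗ[R] S) (β : V →ₗ[R] S →ₗ[R] N) (γ : V →ₗ[R] N →ₗ[R] N) :
    V →ₗ[R] Module.End R (S × N) :=
  LinearMap.mk₂ R (fun v p => (j v * p.1, β v p.1 + γ v p.2))
    (by intros; ext <;> simp [add_mul]; abel) (by intros; ext <;> simp)
    (by intros; ext <;> simp [mul_add]; abel) (by intros; ext <;> simp)

theorem recStep_apply (j : V →ₗ[R] S) (β : V →ₗ[R] S →ₗ[R] N) (γ : V →ₗ[R] N →ₗ[R] N) (v : V)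
    (p : S × N) : recStep j β γ v p = (j v * p.1, β v p.1 + γ v p.2) := rfl

theorem fst_apply_of_recStep {j : V →ₗ[R] S} {β : V →ₗ[R] S →ₗ[R] N} {γ : V →ₗ[R] N →ₗ[R] N}
    (hj : Algebra.adjoin R (Set.range j) = ⊤) {Φ : S →ₐ[R] Module.End R (S × N)}
    (hΦ : ∀ v, Φ (j v) = recStep j β γ v) (s : S) (p : S × N) : (Φ s p).1 = s * p.1 := by
  have hs : s ∈ Algebra.adjoin R (Set.range j) := hj ▸ Algebra.mem_top
  induction hs using Algebra.adjoin_induction generalizing p with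
  | mem s hs =>
    obtain ⟨v, rfl⟩ := hs
    rw [hΦ, recStep_apply]
  | algebraMap r => simp [Module.algebraMap_end_apply, Algebra.smul_def]
  | mul a b _ _ ha hb => rw [map_mul, Module.End.mul_apply, ha, hb, mul_assoc]
  | add a b _ _ ha hb => rw [map_add, LinearMap.add_apply, Prod.fst_add, ha, hb, add_mul]

variable (n₀ : N) (β : V →ₗ[R] TensorAlgebra R V →ₗ[R] N) (γ : V →ₗ[R] N →ₗ[R] N)

/-- The linear map `F` on the tensor algebra defined by recursion on the first letter:
`F 1 = n₀` and `F (v t) = β v t + γ v (F t)`. -/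
def tensorRec : TensorAlgebra R V →ₗ[R] N :=
  LinearMap.snd R _ _ ∘ₗ LinearMap.applyₗ (R := R) ((1, n₀) : TensorAlgebra R V × N) ∘ₗ
    (TensorAlgebra.lift R (recStep (TensorAlgebra.ι R) β γ)).toLinearMap

theorem tensorRec_one : tensorRec n₀ β γ 1 = n₀ := by
  simp [tensorRec]

theorem tensorRec_ι_mul (v : V) (t : TensorAlgebra R V) :
    tensorRec n₀ β γ (TensorAlgebra.ι R v * t) = β v t + γ v (tensorRec n₀ β γ t) := by
  have hfst := fst_apply_of_recStep TensorAlgebra.adjoin_range_ι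
    (TensorAlgebra.lift_ι_apply (recStep (TensorAlgebra.ι R) β γ)) t (1, n₀)
  rw [mul_one] at hfst
  simp only [tensorRec, LinearMap.comp_apply, AlgHom.toLinearMap_apply, map_mul,
    TensorAlgebra.lift_ι_apply, LinearMap.applyₗ_apply_apply, Module.End.mul_apply, recStep_apply,
    LinearMap.snd_apply, hfst]

end Generation

section Words

variable {V : Type*} [AddCommGroup V] [Module ℝ V] {𝒱 : ℤ → Submodule ℝ V}

/-- The degree of a word in the tensor algebra of `V[1]`, that is `wordDeg w + 1`. -/
def degSum (w : List (Letter 𝒱)) : ℤ := (w.map letterDeg).sum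

@[simp] theorem degSum_nil : degSum ([] : List (Letter 𝒱)) = 0 := rfl

@[simp] theorem degSum_cons (a : Letter 𝒱) (w) : degSum (a :: w) = letterDeg a + degSum w := rfl

/-- A letter, as a tensor of length one. -/
def letterTens (a : Letter 𝒱) : TensorAlgebra ℝ V := TensorAlgebra.ι ℝ (a.2 : V)

@[simp] theorem tens_nil : tens ([] : List (Letter 𝒱)) = 1 := rfl

@[simp] theorem tens_cons (a : Letter 𝒱) (w) : tens (a :: w) = letterTens a * tens w := rfl

theorem span_range_letter (hV : DirectSum.IsInternal 𝒱) :
    Submodule.span ℝ (Set.range fun a : Letter 𝒱 => (a.2 : V)) = ⊤ := by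
  rw [← hV.submodule_iSup_eq_top, Submodule.iSup_eq_span]
  congr 1
  ext v
  simp

theorem span_range_tens (hV : DirectSum.IsInternal 𝒱) :
    Submodule.span ℝ (Set.range (tens (𝒱 := 𝒱))) = ⊤ := by
  refine span_range_prod_map_eq_top ?_
  rw [← Algebra.adjoin_span, Set.range_comp' (TensorAlgebra.ι ℝ) fun a : Letter 𝒱 => (a.2 : V),
    ← Submodule.map_span, span_range_letter hV, Submodule.map_top, LinearMap.coe_range,
    TensorAlgebra.adjoin_range_ι]

theorem tensorAlgebra_linearMap_ext (hV : DirectSum.IsInternal 𝒱) {N : Type*} [AddCommGroup N]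
    [Module ℝ N] {f g : TensorAlgebra ℝ V →ₗ[ℝ] N}
    (h : ∀ w : List (Letter 𝒱), f (tens w) = g (tens w)) : f = g :=
  LinearMap.ext_on (span_range_tens hV) (by rintro _ ⟨w, rfl⟩; exact h w)

variable (hV : DirectSum.IsInternal 𝒱)

/-- The linear map `b ↦ (-1)^(d * deg b) b`: the sign of moving `b` past an element of
degree `d`. -/
def signTwist (d : ℤ) : V →ₗ[ℝ] V :=
  gradedLift hV fun i => koszul d (i - 1) • (𝒱 i).subtype

theorem signTwist_letter (d : ℤ) (b : Letter 𝒱) :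
    signTwist hV d b.2 = koszul d (letterDeg b) • (b.2 : V) :=
  gradedLift_of_mem hV _ b.2.2

/-- The linear extension to all tensors of the shuffle product by the word `x` on the left, see
`shuffleProd_eq_shuffleMap`.  A shuffle of `a :: x` and `b :: y` starts with `a` or with `b`. -/
def shuffleMap : List (Letter 𝒱) → TensorAlgebra ℝ V →ₗ[ℝ] TensorAlgebra ℝ V
  | [] => LinearMap.id
  | a :: x => tensorRec (tens (a :: x))
      (((LinearMap.mul ℝ (TensorAlgebra ℝ V)).compr₂
        (LinearMap.mulLeft ℝ (letterTens a) ∘ₗ shuffleMap x)) ∘ₗ TensorAlgebra.ι ℝ)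
      (LinearMap.mul ℝ (TensorAlgebra ℝ V) ∘ₗ TensorAlgebra.ι ℝ ∘ₗ signTwist hV (degSum (a :: x)))

local infix:75 " ⧢ " => shuffleMap hV

@[simp] theorem shuffleMap_nil (t) : [] ⧢ t = t := rfl

@[simp] theorem shuffleMap_one (x) : x ⧢ 1 = tens x := by
  cases x with
  | nil => rfl
  | cons a x => exact tensorRec_one _ _ _

theorem shuffleMap_cons (a : Letter 𝒱) (x) (b : Letter 𝒱) (t) :
    (a :: x) ⧢ (letterTens b * t) = letterTens a * x ⧢ (letterTens b * t) +
      koszul (degSum (a :: x)) (letterDeg b) • (letterTens b * (a :: x) ⧢ t) := by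
  simp [shuffleMap, letterTens, tensorRec_ι_mul, signTwist_letter]

theorem shuffleMap_comm (x y : List (Letter 𝒱)) :
    x ⧢ tens y = koszul (degSum x) (degSum y) • y ⧢ tens x := by
  induction x generalizing y with
  | nil => simp
  | cons a x ihx =>
    induction y with
    | nil => simp
    | cons b y ihy =>
      have hx := ihx (b :: y)
      simp only [tens_cons] at hx ihy ⊢
      rw [shuffleMap_cons, shuffleMap_cons, hx, ihy]
      simp only [mul_smul_comm, smul_add, smul_smul, degSum_cons, koszul_add_left,
        koszul_add_right]
      match_scalars <;> grind

theorem shuffleMap_shuffleMap_cons (a : Letter 𝒱) (x) (b : Letter 𝒱) (y) (c : Letter 𝒱) (t) :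
    (a :: x) ⧢ ((b :: y) ⧢ (letterTens c * t)) =
      letterTens a * x ⧢ ((b :: y) ⧢ (letterTens c * t)) +
      koszul (degSum (a :: x)) (letterDeg b) •
        (letterTens b * (a :: x) ⧢ (y ⧢ (letterTens c * t))) +
      (koszul (degSum (b :: y)) (letterDeg c) * koszul (degSum (a :: x)) (letterDeg c)) •
        (letterTens c * (a :: x) ⧢ ((b :: y) ⧢ t)) := by
  simp only [shuffleMap_cons, map_add, map_smul, mul_add, mul_smul_comm]
  module

theorem shuffleMap_left_comm (x y : List (Letter 𝒱)) (t : TensorAlgebra ℝ V) :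
    x ⧢ (y ⧢ t) = koszul (degSum x) (degSum y) • y ⧢ (x ⧢ t) := by
  suffices hwords : ∀ z : List (Letter 𝒱),
      x ⧢ (y ⧢ tens z) = koszul (degSum x) (degSum y) • y ⧢ (x ⧢ tens z) from
    LinearMap.congr_fun (f := shuffleMap hV x ∘ₗ shuffleMap hV y)
      (g := koszul (degSum x) (degSum y) • (shuffleMap hV y ∘ₗ shuffleMap hV x))
      (tensorAlgebra_linearMap_ext hV hwords) t
  clear t
  induction x generalizing y with
  | nil => simp
  | cons a x ihx =>
    induction y with
    | nil => simp
    | cons b y ihy =>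
      intro z
      induction z with
      | nil => simpa using shuffleMap_comm hV (a :: x) (b :: y)
      | cons c z ihz =>
        have hx := ihx (b :: y) (c :: z)
        have hy := ihy (c :: z)
        simp only [tens_cons] at hx hy ihz ⊢
        rw [shuffleMap_shuffleMap_cons, shuffleMap_shuffleMap_cons, hx, hy, ihz]
        simp only [mul_smul_comm, smul_add, smul_smul, degSum_cons, koszul_add_left,
          koszul_add_right]
        match_scalars <;> grind

theorem shuffleMap_rotate (x y z : List (Letter 𝒱)) :
    z ⧢ (x ⧢ tens y) = koszul (degSum z) (degSum x + degSum y) • x ⧢ (y ⧢ tens z) := by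
  rw [shuffleMap_left_comm, shuffleMap_comm hV z y, map_smul, smul_smul, koszul_add_right]

end Words

namespace GerstenhaberAlgebra

variable {G : Type*} [AddCommGroup G] [Module ℝ G] (A : GerstenhaberAlgebra G)

local infix:75 " ⧢ " => shuffleMap A.isInternal

/-- The product of two letters. -/
def mulLetter (a b : Letter A.grade) : Letter A.grade :=
  ⟨a.1 + b.1, A.mul a.2 b.2, A.mul_mem a.2.2 b.2.2⟩

/-- The bracket of two letters. -/
def bracketLetter (a b : Letter A.grade) : Letter A.grade :=
  ⟨a.1 + b.1 - 1, A.bracket a.2 b.2, A.bracket_mem a.2.2 b.2.2⟩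

@[simp] theorem letterDeg_mulLetter (a b : Letter A.grade) :
    letterDeg (A.mulLetter a b) = letterDeg a + letterDeg b + 1 := by
  simp only [letterDeg, mulLetter]; ring

@[simp] theorem letterDeg_bracketLetter (a b : Letter A.grade) :
    letterDeg (A.bracketLetter a b) = letterDeg a + letterDeg b := by
  simp only [letterDeg, bracketLetter]; ring

theorem letterTens_bracketLetter_comm (a b : Letter A.grade) :
    letterTens (A.bracketLetter a b) =
      (-koszul (letterDeg a) (letterDeg b)) • letterTens (A.bracketLetter b a) := by
  simp only [letterTens, bracketLetter]
  rw [A.antisymm a.2.2 b.2.2, map_neg, map_smul, neg_smul]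
  rfl

theorem letterTens_mulLetter_comm (a b : Letter A.grade) :
    letterTens (A.mulLetter a b) =
      koszul (letterDeg a + 1) (letterDeg b + 1) • letterTens (A.mulLetter b a) := by
  simp only [letterTens, mulLetter]
  rw [A.mul_comm a.2.2 b.2.2, koszul, letterDeg, letterDeg, map_smul, sub_add_cancel,
    sub_add_cancel]

theorem letterTens_mulLetter_assoc (a b c : Letter A.grade) :
    letterTens (A.mulLetter (A.mulLetter a b) c) =
      letterTens (A.mulLetter a (A.mulLetter b c)) := by
  simp only [letterTens, mulLetter, A.mul_assoc a.2.2 b.2.2 c.2.2]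

theorem letterTens_bracketLetter_mulLetter (a b c : Letter A.grade) :
    letterTens (A.bracketLetter a (A.mulLetter b c)) =
      letterTens (A.mulLetter (A.bracketLetter a b) c) +
      koszul (letterDeg b + 1) (letterDeg a) •
        letterTens (A.mulLetter b (A.bracketLetter a c)) := by
  simp only [letterTens, mulLetter, bracketLetter]
  rw [A.leibniz a.2.2 b.2.2 c.2.2, map_add, map_smul, koszul, letterDeg, letterDeg,
    sub_add_cancel]

theorem letterTens_bracketLetter_jacobi (a b c : Letter A.grade) :
    letterTens (A.bracketLetter a (A.bracketLetter b c)) =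
      (-koszul (letterDeg a + letterDeg b) (letterDeg c)) •
        letterTens (A.bracketLetter c (A.bracketLetter a b)) +
      (-koszul (letterDeg a) (letterDeg b + letterDeg c)) •
        letterTens (A.bracketLetter b (A.bracketLetter c a)) := by
  have hcyclic : koszul (letterDeg a) (letterDeg c) •
        letterTens (A.bracketLetter (A.bracketLetter a b) c) +
      koszul (letterDeg b) (letterDeg a) •
        letterTens (A.bracketLetter (A.bracketLetter b c) a) +
      koszul (letterDeg c) (letterDeg b) •
        letterTens (A.bracketLetter (A.bracketLetter c a) b) = 0 := by
    simpa [letterTens, bracketLetter, letterDeg, koszul] using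
      congrArg (TensorAlgebra.ι ℝ) (A.jacobi a.2.2 b.2.2 c.2.2)
  rw [A.letterTens_bracketLetter_comm (A.bracketLetter a b),
    A.letterTens_bracketLetter_comm (A.bracketLetter b c),
    A.letterTens_bracketLetter_comm (A.bracketLetter c a)] at hcyclic
  simp only [letterDeg_bracketLetter, smul_smul] at hcyclic
  simp only [koszul_add_left, koszul_add_right] at hcyclic ⊢
  linear_combination (norm := skip) (-koszul (letterDeg a) (letterDeg c)) • hcyclic
  match_scalars <;> grind

/-- The linear extension to all tensors of the bracket `[x ∧ ·]`, see
`bracketTens_eq_bracketMap`. -/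
def bracketMap : List (Letter A.grade) → TensorAlgebra ℝ G →ₗ[ℝ] TensorAlgebra ℝ G
  | [] => 0
  | a :: x => tensorRec 0
      (((LinearMap.mul ℝ (TensorAlgebra ℝ G)).compr₂
        (LinearMap.mulLeft ℝ (letterTens a) ∘ₗ bracketMap x)) ∘ₗ TensorAlgebra.ι ℝ +
        ((LinearMap.mul ℝ (TensorAlgebra ℝ G)).compl₂ (shuffleMap A.isInternal x)) ∘ₗ
          TensorAlgebra.ι ℝ ∘ₗ A.bracket a.2 ∘ₗ signTwist A.isInternal (degSum x))
      (LinearMap.mul ℝ (TensorAlgebra ℝ G) ∘ₗ TensorAlgebra.ι ℝ ∘ₗ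
        signTwist A.isInternal (degSum (a :: x)))

@[simp] theorem bracketMap_nil (t) : A.bracketMap [] t = 0 := rfl

@[simp] theorem bracketMap_one (x) : A.bracketMap x 1 = 0 := by
  cases x with
  | nil => rfl
  | cons a x => exact tensorRec_one _ _ _

theorem bracketMap_cons (a : Letter A.grade) (x) (b : Letter A.grade) (t) :
    A.bracketMap (a :: x) (letterTens b * t) = letterTens a * A.bracketMap x (letterTens b * t) +
      koszul (degSum (a :: x)) (letterDeg b) • (letterTens b * A.bracketMap (a :: x) t) +
      koszul (degSum x) (letterDeg b) • (letterTens (A.bracketLetter a b) * x ⧢ t) := by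
  simp [bracketMap, letterTens, tensorRec_ι_mul, signTwist_letter, bracketLetter]
  abel

theorem bracketMap_antisymm (x y : List (Letter A.grade)) :
    A.bracketMap x (tens y) = (-koszul (degSum x) (degSum y)) • A.bracketMap y (tens x) := by
  induction x generalizing y with
  | nil => simp
  | cons a x ihx =>
    induction y with
    | nil => simp
    | cons b y ihy =>
      have hx := ihx (b :: y)
      simp only [tens_cons] at hx ihy ⊢
      rw [bracketMap_cons, bracketMap_cons, hx, ihy, shuffleMap_comm A.isInternal x y,
        A.letterTens_bracketLetter_comm a b]
      simp only [mul_smul_comm, smul_mul_assoc, smul_add, smul_smul, degSum_cons,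
        koszul_add_left, koszul_add_right]
      match_scalars <;> grind

section ThreeWords

variable (a b c : Letter A.grade) (x y : List (Letter A.grade)) (t : TensorAlgebra ℝ G)

theorem bracketMap_shuffleMap_cons :
    A.bracketMap (a :: x) ((b :: y) ⧢ (letterTens c * t)) =
      letterTens a * A.bracketMap x ((b :: y) ⧢ (letterTens c * t)) +
      koszul (degSum (a :: x)) (letterDeg b) •
        (letterTens b * A.bracketMap (a :: x) (y ⧢ (letterTens c * t))) +
      (koszul (degSum (b :: y)) (letterDeg c) * koszul (degSum (a :: x)) (letterDeg c)) •
        (letterTens c * A.bracketMap (a :: x) ((b :: y) ⧢ t)) +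
      koszul (degSum x) (letterDeg b) •
        (letterTens (A.bracketLetter a b) * x ⧢ (y ⧢ (letterTens c * t))) +
      (koszul (degSum (b :: y)) (letterDeg c) * koszul (degSum x) (letterDeg c)) •
        (letterTens (A.bracketLetter a c) * x ⧢ ((b :: y) ⧢ t)) := by
  simp only [shuffleMap_cons, bracketMap_cons, map_add, map_smul, mul_add, mul_smul_comm]
  module

theorem shuffleMap_bracketMap_cons :
    (a :: x) ⧢ A.bracketMap (b :: y) (letterTens c * t) =
      letterTens a * x ⧢ A.bracketMap (b :: y) (letterTens c * t) +
      koszul (degSum (a :: x)) (letterDeg b) •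
        (letterTens b * (a :: x) ⧢ A.bracketMap y (letterTens c * t)) +
      (koszul (degSum (b :: y)) (letterDeg c) * koszul (degSum (a :: x)) (letterDeg c)) •
        (letterTens c * (a :: x) ⧢ A.bracketMap (b :: y) t) +
      (koszul (degSum y) (letterDeg c) *
        koszul (degSum (a :: x)) (letterDeg (A.bracketLetter b c))) •
        (letterTens (A.bracketLetter b c) * (a :: x) ⧢ (y ⧢ t)) := by
  simp only [shuffleMap_cons, bracketMap_cons, map_add, map_smul, mul_add, mul_smul_comm]
  module

theorem bracketMap_bracketMap_cons :
    A.bracketMap (a :: x) (A.bracketMap (b :: y) (letterTens c * t)) =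
      letterTens a * A.bracketMap x (A.bracketMap (b :: y) (letterTens c * t)) +
      koszul (degSum (a :: x)) (letterDeg b) •
        (letterTens b * A.bracketMap (a :: x) (A.bracketMap y (letterTens c * t))) +
      (koszul (degSum (b :: y)) (letterDeg c) * koszul (degSum (a :: x)) (letterDeg c)) •
        (letterTens c * A.bracketMap (a :: x) (A.bracketMap (b :: y) t)) +
      koszul (degSum x) (letterDeg b) •
        (letterTens (A.bracketLetter a b) * x ⧢ A.bracketMap y (letterTens c * t)) +
      (koszul (degSum (b :: y)) (letterDeg c) * koszul (degSum x) (letterDeg c)) •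
        (letterTens (A.bracketLetter a c) * x ⧢ A.bracketMap (b :: y) t) +
      (koszul (degSum y) (letterDeg c) *
        koszul (degSum (a :: x)) (letterDeg (A.bracketLetter b c))) •
        (letterTens (A.bracketLetter b c) * A.bracketMap (a :: x) (y ⧢ t)) +
      (koszul (degSum y) (letterDeg c) * koszul (degSum x) (letterDeg (A.bracketLetter b c))) •
        (letterTens (A.bracketLetter a (A.bracketLetter b c)) * x ⧢ (y ⧢ t)) := by
  simp only [bracketMap_cons, map_add, map_smul, mul_add, mul_smul_comm]
  module

end ThreeWords

theorem bracketMap_shuffleMap (x y z : List (Letter A.grade)) :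
    A.bracketMap x (y ⧢ tens z) =
      koszul (degSum x + degSum y) (degSum z) • z ⧢ A.bracketMap x (tens y) +
      koszul (degSum x) (degSum y) • y ⧢ A.bracketMap x (tens z) := by
  induction x generalizing y z with
  | nil => simp
  | cons a x ihx =>
    induction y generalizing z with
    | nil => simp
    | cons b y ihy =>
      induction z with
      | nil => simp
      | cons c z ihz =>
        have hx := ihx (b :: y) (c :: z)
        have hy := ihy (c :: z)
        have hrotate := shuffleMap_rotate A.isInternal x y (c :: z)
        simp only [tens_cons] at hx hy hrotate ihz ⊢
        rw [bracketMap_shuffleMap_cons, shuffleMap_bracketMap_cons, shuffleMap_bracketMap_cons,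
          hx, hy, ihz, hrotate, shuffleMap_left_comm A.isInternal (b :: y) x (tens z)]
        simp only [mul_smul_comm, smul_add, smul_smul, mul_add, degSum_cons,
          letterDeg_bracketLetter, koszul_add_left, koszul_add_right]
        match_scalars <;> grind

theorem bracketMap_jacobi (x y z : List (Letter A.grade)) :
    A.bracketMap x (A.bracketMap y (tens z)) =
      (-koszul (degSum x + degSum y) (degSum z)) • A.bracketMap z (A.bracketMap x (tens y)) +
      (-koszul (degSum x) (degSum y + degSum z)) • A.bracketMap y (A.bracketMap z (tens x)) := by
  induction x generalizing y z with
  | nil => simp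
  | cons a x ihx =>
    induction y generalizing z with
    | nil => simp
    | cons b y ihy =>
      induction z with
      | nil => simp
      | cons c z ihz =>
        have hx := ihx (b :: y) (c :: z)
        have hy := ihy (c :: z)
        have hzxy := shuffleMap_rotate A.isInternal x y z
        have hyzx := shuffleMap_rotate A.isInternal z x y
        have hder_z := A.bracketMap_shuffleMap (c :: z) x y
        have hder_y := A.bracketMap_shuffleMap (b :: y) z x
        have hder_x := A.bracketMap_shuffleMap (a :: x) y z
        rw [hzxy, smul_smul] at hyzx
        rw [A.bracketMap_antisymm (c :: z) y] at hder_z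
        rw [A.bracketMap_antisymm (b :: y) x] at hder_y
        rw [A.bracketMap_antisymm (a :: x) z] at hder_x
        simp only [tens_cons, map_smul, smul_smul] at hx hy ihz hder_x hder_y hder_z ⊢
        rw [bracketMap_bracketMap_cons, bracketMap_bracketMap_cons, bracketMap_bracketMap_cons,
          hx, hy, ihz, hder_z, hder_y, hder_x, hzxy, hyzx,
          A.letterTens_bracketLetter_jacobi a b c, A.letterTens_bracketLetter_comm b a,
          A.letterTens_bracketLetter_comm c b, A.letterTens_bracketLetter_comm c a]
        simp only [mul_smul_comm, smul_mul_assoc, smul_add, smul_smul, mul_add, add_mul,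
          degSum_cons, letterDeg_bracketLetter, koszul_add_left, koszul_add_right]
        match_scalars <;> grind

/-- Multiplication of the first letter of a tensor by `a` from the left. -/
def headMul : G →ₗ[ℝ] TensorAlgebra ℝ G →ₗ[ℝ] TensorAlgebra ℝ G :=
  (tensorRec 0 (LinearMap.mk₂ ℝ (fun v s => LinearMap.mulRight ℝ s ∘ₗ TensorAlgebra.ι ℝ ∘ₗ
      A.mul.flip v)
    (by intros; ext; simp [add_mul]) (by intros; ext; simp)
    (by intros; ext; simp [mul_add]) (by intros; ext; simp)) 0).flip

@[simp] theorem headMul_one (a : G) : A.headMul a 1 = 0 := by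
  simp [headMul, tensorRec_one]

@[simp] theorem headMul_letterTens_mul (a b : Letter A.grade) (t) :
    A.headMul a.2 (letterTens b * t) = letterTens (A.mulLetter a b) * t := by
  simp [headMul, letterTens, tensorRec_ι_mul, mulLetter]

/-- The linear extension of `A.mulTens` to all tensors, see `mulTens_eq_mulMap`. -/
def mulMap : TensorAlgebra ℝ G →ₗ[ℝ] TensorAlgebra ℝ G :=
  tensorRec 0 (A.headMul ∘ₗ signTwist A.isInternal 1)
    (LinearMap.mul ℝ (TensorAlgebra ℝ G) ∘ₗ TensorAlgebra.ι ℝ ∘ₗ signTwist A.isInternal 1)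

@[simp] theorem mulMap_one : A.mulMap 1 = 0 := tensorRec_one _ _ _

theorem mulMap_letterTens_mul (a : Letter A.grade) (t) :
    A.mulMap (letterTens a * t) =
      koszul 1 (letterDeg a) • (A.headMul a.2 t + letterTens a * A.mulMap t) := by
  simp [mulMap, letterTens, tensorRec_ι_mul, signTwist_letter]

theorem headMul_headMul (a b : Letter A.grade) (x : List (Letter A.grade)) :
    A.headMul a.2 (A.headMul b.2 (tens x)) = A.headMul (A.mulLetter a b).2 (tens x) := by
  cases x with
  | nil => simp
  | cons c x => simp only [tens_cons, headMul_letterTens_mul, letterTens_mulLetter_assoc]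

theorem mulMap_mulMap (t : TensorAlgebra ℝ G) : A.mulMap (A.mulMap t) = 0 := by
  suffices hwords : ∀ w : List (Letter A.grade), A.mulMap (A.mulMap (tens w)) = 0 from
    LinearMap.congr_fun (f := A.mulMap ∘ₗ A.mulMap) (g := 0)
      (tensorAlgebra_linearMap_ext A.isInternal hwords) t
  intro w
  induction w with
  | nil => simp
  | cons a w ih =>
    cases w with
    | nil => rw [tens_cons, mulMap_letterTens_mul]; simp
    | cons b w =>
      have hhead := A.headMul_headMul a b w
      rw [tens_cons, mulMap_letterTens_mul, map_smul, map_add, mulMap_letterTens_mul, ih, tens_cons,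
        headMul_letterTens_mul, mulMap_letterTens_mul, mulMap_letterTens_mul, map_smul, map_add,
        hhead, headMul_letterTens_mul, letterDeg_mulLetter]
      simp only [mul_zero, add_zero, smul_add, smul_smul, koszul_add_right]
      match_scalars <;> grind

/-- The part of `a · (x ⧢ y)` with the first letter of `x` absorbed by `a`. -/
def headShuffle (a : Letter A.grade) : List (Letter A.grade) → List (Letter A.grade) →
    TensorAlgebra ℝ G
  | [], _ => 0
  | b :: x, y => letterTens (A.mulLetter a b) * x ⧢ tens y

@[simp] theorem headShuffle_nil (a : Letter A.grade) (y) : A.headShuffle a [] y = 0 := rfl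

@[simp] theorem headShuffle_cons (a b : Letter A.grade) (x y) :
    A.headShuffle a (b :: x) y = letterTens (A.mulLetter a b) * x ⧢ tens y := rfl

theorem headMul_shuffleMap (a : Letter A.grade) (x y : List (Letter A.grade)) :
    A.headMul a.2 (x ⧢ tens y) = A.headShuffle a x y +
      koszul (degSum x) (degSum y) • A.headShuffle a y x := by
  cases x with
  | nil => cases y <;> simp
  | cons b x =>
    cases y with
    | nil => simp
    | cons c y =>
      have hcomm := shuffleMap_comm A.isInternal (b :: x) y
      simp only [tens_cons, shuffleMap_cons, headShuffle_cons, map_add, map_smul,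
        headMul_letterTens_mul] at hcomm ⊢
      rw [hcomm]
      simp only [mul_smul_comm, smul_smul, degSum_cons, koszul_add_right]

theorem shuffleMap_headMul (a b : Letter A.grade) (x y : List (Letter A.grade)) :
    (b :: y) ⧢ A.headMul a.2 (tens x) = letterTens b * y ⧢ A.headMul a.2 (tens x) +
      koszul (degSum (b :: y)) (letterDeg a + degSum x + 1) • A.headShuffle a x (b :: y) := by
  cases x with
  | nil => simp
  | cons c x =>
    have hcomm := shuffleMap_comm A.isInternal (b :: y) x
    simp only [tens_cons, headMul_letterTens_mul, shuffleMap_cons, headShuffle_cons] at hcomm ⊢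
    rw [hcomm]
    simp only [mul_smul_comm, smul_smul, degSum_cons, letterDeg_mulLetter, koszul_add_left,
      koszul_add_right]
    match_scalars <;> grind

theorem letterTens_mulLetter_bracketLetter_comm (a b c : Letter A.grade) :
    letterTens (A.mulLetter a (A.bracketLetter b c)) = (-koszul (letterDeg b) (letterDeg c)) •
      letterTens (A.mulLetter a (A.bracketLetter c b)) := by
  simp only [letterTens, mulLetter, bracketLetter]
  rw [A.antisymm b.2.2 c.2.2, koszul, letterDeg, letterDeg]
  simp

theorem letterTens_bracketLetter_comm_mulLetter (a b c : Letter A.grade) :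
    letterTens (A.mulLetter (A.bracketLetter a b) c) = (-koszul (letterDeg a) (letterDeg b)) •
      letterTens (A.mulLetter (A.bracketLetter b a) c) := by
  simp only [letterTens, mulLetter, bracketLetter]
  rw [A.antisymm a.2.2 b.2.2, koszul, letterDeg, letterDeg]
  simp

theorem headShuffle_bracketLetter_comm (a b : Letter A.grade) (x y : List (Letter A.grade)) :
    A.headShuffle (A.bracketLetter a b) x y =
      (-koszul (letterDeg a) (letterDeg b)) • A.headShuffle (A.bracketLetter b a) x y := by
  cases x with
  | nil => simp
  | cons c x =>
    rw [headShuffle_cons, headShuffle_cons, letterTens_bracketLetter_comm_mulLetter,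
      smul_mul_assoc]

theorem mulMap_shuffleMap (x y : List (Letter A.grade)) :
    A.mulMap (x ⧢ tens y) = koszul (degSum x + 1) (degSum y) • y ⧢ A.mulMap (tens x) +
      koszul 1 (degSum x) • x ⧢ A.mulMap (tens y) := by
  induction x generalizing y with
  | nil => simp
  | cons a x ihx =>
    induction y with
    | nil => simp
    | cons b y ihy =>
      have hx := ihx (b :: y)
      have hhead_a := A.headMul_shuffleMap a x (b :: y)
      have hhead_b := A.headMul_shuffleMap b (a :: x) y
      simp only [tens_cons, headShuffle_cons] at hx hhead_a hhead_b ihy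
      simp only [tens_cons, mulMap_letterTens_mul, shuffleMap_cons, map_add, map_smul]
      rw [hx, hhead_a, hhead_b, ihy, shuffleMap_headMul, shuffleMap_headMul, mulMap_letterTens_mul,
        mulMap_letterTens_mul, shuffleMap_comm A.isInternal x y, A.letterTens_mulLetter_comm a b]
      simp only [map_add, map_smul, mul_smul_comm, smul_mul_assoc, smul_smul, smul_add, mul_add,
        degSum_cons, koszul_add_left, koszul_add_right]
      match_scalars <;> grind

theorem headMul_bracketMap (a b : Letter A.grade) (x y : List (Letter A.grade)) :
    A.headMul a.2 (A.bracketMap x (tens (b :: y))) =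
      (-koszul (letterDeg a + degSum x + 1) (degSum (b :: y))) •
        (A.bracketMap (b :: y) (A.headMul a.2 (tens x)) -
          letterTens b * A.bracketMap y (A.headMul a.2 (tens x))) +
      koszul (degSum x) (letterDeg b) •
        (letterTens (A.mulLetter a b) * A.bracketMap x (tens y)) +
      (-koszul (letterDeg b) (degSum x + 1)) • A.headShuffle (A.bracketLetter a b) x y := by
  cases x with
  | nil => simp
  | cons c x =>
    have hanti := A.bracketMap_antisymm (b :: y) x
    simp only [tens_cons, headMul_letterTens_mul, bracketMap_cons, headShuffle_cons, map_add,
      map_smul] at hanti ⊢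
    rw [hanti, shuffleMap_comm A.isInternal y x, letterTens_bracketLetter_mulLetter,
      A.letterTens_bracketLetter_comm_mulLetter b a,
      A.letterTens_mulLetter_bracketLetter_comm a b c]
    simp only [mul_smul_comm, smul_mul_assoc, smul_smul, smul_add, add_mul,
      degSum_cons, letterDeg_mulLetter, koszul_add_left, koszul_add_right]
    match_scalars <;> grind

theorem mulMap_bracketMap (x y : List (Letter A.grade)) :
    A.mulMap (A.bracketMap x (tens y)) =
      (-koszul (degSum x + 1) (degSum y)) • A.bracketMap y (A.mulMap (tens x)) +
      koszul 1 (degSum x) • A.bracketMap x (A.mulMap (tens y)) := by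
  induction x generalizing y with
  | nil => simp
  | cons a x ihx =>
    induction y with
    | nil => simp
    | cons b y ihy =>
      have hx := ihx (b :: y)
      have hhead_a := A.headMul_bracketMap a b x y
      have hhead_b := A.headMul_bracketMap b a y x
      have hhead_ab := A.headMul_shuffleMap (A.bracketLetter a b) x y
      have hanti := A.bracketMap_antisymm (a :: x) y
      rw [A.headShuffle_bracketLetter_comm b a y x] at hhead_b
      simp only [tens_cons] at hx hhead_a hhead_b hanti ihy
      simp only [tens_cons, bracketMap_cons, mulMap_letterTens_mul, map_add, map_smul]
      rw [hx, hhead_a, ihy, hhead_ab, hanti, map_smul, hhead_b,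
        mulMap_letterTens_mul, mulMap_letterTens_mul, A.bracketMap_antisymm x y,
        A.mulMap_shuffleMap x y, A.letterTens_mulLetter_comm a b,
        A.letterTens_bracketLetter_comm b a]
      simp only [map_add, map_smul, mul_smul_comm, smul_mul_assoc, smul_smul, smul_add, mul_add,
        smul_sub, degSum_cons, letterDeg_bracketLetter, koszul_add_left, koszul_add_right]
      match_scalars <;> grind

end GerstenhaberAlgebra

section InsertPerm

variable {n : ℕ}

/-- The permutation sending `i` to `0` and acting on the other indices as `e`. -/
def insertPerm (i : Fin (n + 1)) (e : Equiv.Perm (Fin n)) : Equiv.Perm (Fin (n + 1)) :=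
  (finSuccEquiv' i).trans ((Equiv.optionCongr e).trans (finSuccEquiv' 0).symm)

variable (i : Fin (n + 1)) (e : Equiv.Perm (Fin n))

@[simp] theorem insertPerm_self : insertPerm i e i = 0 := by simp [insertPerm]

@[simp] theorem insertPerm_succAbove (k : Fin n) :
    insertPerm i e (i.succAbove k) = (e k).succ := by simp [insertPerm]

@[simp] theorem insertPerm_inv_zero : (insertPerm i e)⁻¹ 0 = i := by
  rw [Equiv.Perm.inv_eq_iff_eq, insertPerm_self]

@[simp] theorem insertPerm_inv_succ (k : Fin n) :
    (insertPerm i e)⁻¹ k.succ = i.succAbove (e⁻¹ k) := by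
  rw [Equiv.Perm.inv_eq_iff_eq]; simp

theorem insertPerm_bijective :
    Function.Bijective fun q : Fin (n + 1) × Equiv.Perm (Fin n) => insertPerm q.1 q.2 := by
  rw [Fintype.bijective_iff_injective_and_card]
  constructor
  · rintro ⟨i, e⟩ ⟨i', e'⟩ (h : insertPerm i e = insertPerm i' e')
    obtain rfl : i = i' := by rw [← insertPerm_inv_zero i e, h, insertPerm_inv_zero]
    congr 1
    ext k : 1
    simpa using DFunLike.congr_fun h (i.succAbove k)
  · simp [Fintype.card_perm, Nat.factorial_succ]

theorem sum_perm_fin_succ {N : Type*} [AddCommMonoid N] (f : Equiv.Perm (Fin (n + 1)) → N) :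
    ∑ σ, f σ = ∑ i, ∑ e, f (insertPerm i e) := by
  rw [← Fintype.sum_prod_type' fun i e => f (insertPerm i e)]
  exact (insertPerm_bijective.sum_comp f).symm

end InsertPerm

section Shuffles

variable {n : ℕ}

theorem mem_shuffles {p : ℕ} {σ : Equiv.Perm (Fin n)} : σ ∈ shuffles p n ↔
    ∀ i j : Fin n, i < j → ((j : ℕ) < p ∨ p ≤ (i : ℕ)) → σ i < σ j := by
  simp [shuffles]

theorem shuffles_eq_singleton_one {p : ℕ} (hp : p = 0 ∨ n ≤ p) : shuffles p n = {1} := by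
  ext σ
  rw [mem_shuffles, Finset.mem_singleton]
  constructor
  · intro h
    have hσ : StrictMono σ := fun i j hij => h i j hij (by lia)
    exact Equiv.coe_fn_injective ((hσ.range_inj strictMono_id).1 (by simp [σ.surjective.range_eq]))
  · rintro rfl i j hij -
    exact hij

variable (i : Fin (n + 1)) (e : Equiv.Perm (Fin n))

theorem eq_zero_or_eq_of_insertPerm_mem_shuffles {p : ℕ} (h : insertPerm i e ∈ shuffles p (n + 1)) :
    i = 0 ∨ (i : ℕ) = p := by
  rw [mem_shuffles] at h
  by_contra! hi
  rcases lt_or_gt_of_ne hi.2 with hip | hpi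
  · simpa using h 0 i (Fin.pos_iff_ne_zero.2 hi.1) (Or.inl hip)
  · simpa using h ⟨p, hpi.trans i.2⟩ i hpi (Or.inr le_rfl)

theorem insertPerm_zero_mem_shuffles (q : ℕ) :
    insertPerm 0 e ∈ shuffles (q + 1) (n + 1) ↔ e ∈ shuffles q n := by
  have hsucc (k : Fin n) : insertPerm 0 e k.succ = (e k).succ := insertPerm_succAbove 0 e k
  simp [mem_shuffles, Fin.forall_fin_succ, hsucc]

theorem insertPerm_mem_shuffles :
    insertPerm i e ∈ shuffles i (n + 1) ↔ e ∈ shuffles i n := by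
  have hlt (k : Fin n) : i.succAbove k < i ↔ (k : ℕ) < i := Fin.succAbove_lt_iff_castSucc_lt i k
  have hle (k : Fin n) : i ≤ i.succAbove k ↔ (i : ℕ) ≤ k := by rw [← not_lt, hlt, not_lt]
  simp only [mem_shuffles, Fin.val_fin_lt, Fin.val_fin_le, Fin.forall_iff_succAbove i, hlt, hle,
    insertPerm_self, insertPerm_succAbove, Fin.succAbove_lt_succAbove_iff, Fin.succ_lt_succ_iff,
    Fin.succ_pos, lt_self_iff_false, false_imp_iff, imp_true_iff, true_and, Fin.not_lt_zero]
  grind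

theorem sum_shuffles_succ {N : Type*} [AddCommMonoid N] (f : Equiv.Perm (Fin (n + 1)) → N)
    (i : Fin n) : ∑ σ ∈ shuffles (i + 1) (n + 1), f σ =
      ∑ e ∈ shuffles i n, f (insertPerm 0 e) +
        ∑ e ∈ shuffles (i + 1) n, f (insertPerm i.succ e) := by
  have hsum {k : ℕ} (p : ℕ) (g : Equiv.Perm (Fin k) → N) :
      ∑ σ ∈ shuffles p k, g σ = ∑ σ, if σ ∈ shuffles p k then g σ else 0 := by
    rw [Finset.sum_ite_mem, Finset.univ_inter]
  have hvanish (j : Fin n) (hj : j ≠ i) (e : Equiv.Perm (Fin n)) :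
      insertPerm j.succ e ∉ shuffles (i + 1) (n + 1) := fun h =>
    (eq_zero_or_eq_of_insertPerm_mem_shuffles _ _ h).elim (Fin.succ_ne_zero j)
      fun h => hj (Fin.ext (Nat.succ_injective h))
  have hmem (e : Equiv.Perm (Fin n)) :
      insertPerm i.succ e ∈ shuffles (i + 1) (n + 1) ↔ e ∈ shuffles (i + 1) n :=
    insertPerm_mem_shuffles i.succ e
  simp only [hsum]
  rw [sum_perm_fin_succ, Fin.sum_univ_succ, Finset.sum_eq_single i
    (fun j _ hj => Finset.sum_eq_zero fun e _ => if_neg (hvanish j hj e)) (by simp)]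
  simp only [insertPerm_zero_mem_shuffles, hmem]

end Shuffles

section ShuffleSum

variable {V N : Type*} [AddCommGroup V] [Module ℝ V] {𝒱 : ℤ → Submodule ℝ V}
  [AddCommGroup N] [Module ℝ N]

/-- The Koszul sign of a permutation of a finite family of letters. -/
def koszulFam {n : ℕ} (b : Fin n → Letter 𝒱) (σ : Equiv.Perm (Fin n)) : ℝ :=
  ∏ i, ∏ j, if i < j ∧ σ j < σ i then koszul (letterDeg (b i)) (letterDeg (b j)) else 1

theorem koszul_sum_left {ι : Type*} (s : Finset ι) (d : ι → ℤ) (k : ℤ) :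
    koszul (∑ i ∈ s, d i) k = ∏ i ∈ s, koszul (d i) k := by
  classical
  induction s using Finset.induction_on with
  | empty => simp
  | insert i s hi ih => rw [Finset.sum_insert hi, Finset.prod_insert hi, koszul_add_left, ih]

@[simp] theorem koszulFam_one {n : ℕ} (b : Fin n → Letter 𝒱) : koszulFam b 1 = 1 :=
  Finset.prod_eq_one fun _ _ => Finset.prod_eq_one fun _ _ => if_neg fun h => h.1.asymm h.2

theorem koszulFam_insertPerm {n : ℕ} (b : Fin (n + 1) → Letter 𝒱) (i : Fin (n + 1))
    (e : Equiv.Perm (Fin n)) : koszulFam b (insertPerm i e) =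
      koszul (degSum ((List.ofFn b).take i)) (letterDeg (b i)) *
        koszulFam (i.removeNth b) e := by
  have hdeg : degSum ((List.ofFn b).take i) = ∑ j with j < i, letterDeg (b j) := by
    rw [degSum, List.map_take, List.map_ofFn, List.sum_take_ofFn]
    rfl
  have hpos (j : Fin (n + 1)) : (j < i ∧ 0 < insertPerm i e j) ↔ j < i := by
    refine ⟨And.left, fun hj => ⟨hj, Fin.pos_iff_ne_zero.2 fun h => hj.ne ?_⟩⟩
    rw [← insertPerm_self i e] at h
    exact (insertPerm i e).injective h
  rw [hdeg, koszul_sum_left, Finset.prod_filter, koszulFam]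
  simp only [Fin.prod_univ_succAbove _ i, insertPerm_self, hpos]
  simp only [insertPerm_succAbove, Fin.not_lt_zero, and_false, if_false, Finset.prod_const_one,
    Finset.prod_mul_distrib, Fin.succAbove_lt_succAbove_iff, Fin.succ_lt_succ_iff,
    lt_self_iff_false, one_mul]
  rfl

/-- The signed sum over all shuffles of the values of `F` on the shuffled word, in which each
letter is marked according to the block it comes from. -/
def shuffleSumFam {n : ℕ} (F : List (Letter 𝒱 × Bool) → N) (b : Fin n → Letter 𝒱) (p : ℕ) : N :=
  ∑ σ ∈ shuffles p n, koszulFam b σ •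
    F (List.ofFn fun k => (b (σ⁻¹ k), decide (((σ⁻¹ k : Fin n) : ℕ) < p)))

theorem shuffleSumFam_of_trivial {n p : ℕ} (hp : p = 0 ∨ n ≤ p) (F : List (Letter 𝒱 × Bool) → N)
    (b : Fin n → Letter 𝒱) :
    shuffleSumFam F b p = F (List.ofFn fun k => (b k, decide ((k : ℕ) < p))) := by
  rw [shuffleSumFam, shuffles_eq_singleton_one hp, Finset.sum_singleton, koszulFam_one, one_smul]
  rfl

theorem shuffleSumFam_succ {n : ℕ} (F : List (Letter 𝒱 × Bool) → N) (b : Fin (n + 1) → Letter 𝒱)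
    (i : Fin n) : shuffleSumFam F b (i + 1) =
      shuffleSumFam (fun w => F ((b 0, true) :: w)) (Fin.removeNth 0 b) i +
        koszul (degSum ((List.ofFn b).take (i + 1))) (letterDeg (b i.succ)) •
          shuffleSumFam (fun w => F ((b i.succ, false) :: w)) (i.succ.removeNth b) (i + 1) := by
  have hlt (k : Fin n) : (i.succ.succAbove k : ℕ) < i + 1 ↔ (k : ℕ) < i + 1 :=
    Fin.succAbove_lt_iff_castSucc_lt i.succ k
  rw [shuffleSumFam, sum_shuffles_succ]
  simp only [koszulFam_insertPerm, List.ofFn_succ, insertPerm_inv_zero, insertPerm_inv_succ, hlt,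
    shuffleSumFam, Finset.smul_sum, smul_smul]
  simp [Fin.removeNth]

theorem shuffleSumFam_congr {n m : ℕ} (F : List (Letter 𝒱 × Bool) → N) (b : Fin n → Letter 𝒱)
    (b' : Fin m → Letter 𝒱) (h : List.ofFn b = List.ofFn b') (p : ℕ) :
    shuffleSumFam F b p = shuffleSumFam F b' p := by
  obtain rfl : n = m := by simpa using congrArg List.length h
  rw [List.ofFn_injective h]

/-- The signed sum of the values of `F` over all shuffles of two words, whose letters are marked
with `true` if they come from the first word. -/
def shuffleSum (F : List (Letter 𝒱 × Bool) → N) (x y : List (Letter 𝒱)) : N :=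
  shuffleSumFam F (x ++ y).get x.length

theorem shuffleSum_nil (F : List (Letter 𝒱 × Bool) → N) (y : List (Letter 𝒱)) :
    shuffleSum F [] y = F (y.map (·, false)) := by
  exact (shuffleSumFam_of_trivial (Or.inl rfl) F _).trans
    (congrArg F (List.ext_getElem (by simp) (by simp)))

theorem shuffleSum_nil_right (F : List (Letter 𝒱 × Bool) → N) (x : List (Letter 𝒱)) :
    shuffleSum F x [] = F (x.map (·, true)) := by
  rw [shuffleSum, shuffleSumFam_of_trivial (Or.inr (by simp))]
  congr 1
  rw [List.ext_get_iff]
  simp +contextual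

theorem ofFn_removeNth_get_cons {α : Type*} (a : α) (l : List α) (i : Fin (l.length + 1)) :
    List.ofFn (i.removeNth (a :: l).get) = (a :: l).eraseIdx i := by
  refine List.ext_getElem (by simp [List.length_eraseIdx, Nat.lt_succ_iff.1 i.2]) fun k _ _ => ?_
  rw [List.getElem_ofFn, List.getElem_eraseIdx, Fin.removeNth, Fin.succAbove]
  simp only [Fin.lt_def, Fin.val_castSucc, List.get_eq_getElem]
  split_ifs <;> rfl

theorem shuffleSum_cons_cons (F : List (Letter 𝒱 × Bool) → N) (a : Letter 𝒱) (x)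
    (b : Letter 𝒱) (y) : shuffleSum F (a :: x) (b :: y) =
      shuffleSum (fun w => F ((a, true) :: w)) x (b :: y) +
        koszul (degSum (a :: x)) (letterDeg b) •
          shuffleSum (fun w => F ((b, false) :: w)) (a :: x) y := by
  let i : Fin (x ++ b :: y).length := ⟨x.length, by simp⟩
  have hb : (a :: (x ++ b :: y)).get i.succ = b := by simp [i]
  have htake : (List.ofFn (a :: (x ++ b :: y)).get).take (i + 1) = a :: x := by
    rw [List.ofFn_get]; simp [i]
  have herase : List.ofFn (i.succ.removeNth (a :: (x ++ b :: y)).get) =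
      List.ofFn (a :: x ++ y).get := by
    rw [ofFn_removeNth_get_cons, List.ofFn_get]
    simp [i, List.eraseIdx_append_of_length_le]
  refine (shuffleSumFam_succ F (a :: (x ++ b :: y)).get i).trans ?_
  rw [hb, htake]
  exact congrArg (_ + koszul _ _ • ·) (shuffleSumFam_congr _ _ (a :: x ++ y).get herase _)

variable (x y : List (Letter 𝒱))

theorem shuffleSum_add (F F' : List (Letter 𝒱 × Bool) → N) :
    shuffleSum (fun w => F w + F' w) x y = shuffleSum F x y + shuffleSum F' x y := by
  simp [shuffleSum, shuffleSumFam, Finset.sum_add_distrib]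

theorem shuffleSum_zero : shuffleSum (fun _ => (0 : N)) x y = 0 := by
  simp [shuffleSum, shuffleSumFam]

theorem shuffleSum_mul_left (t : TensorAlgebra ℝ V)
    (F : List (Letter 𝒱 × Bool) → TensorAlgebra ℝ V) :
    shuffleSum (fun w => t * F w) x y = t * shuffleSum F x y := by
  simp [shuffleSum, shuffleSumFam, Finset.mul_sum]

end ShuffleSum

section AdjacentSum

variable {α N : Type*} [AddCommMonoid N]

/-- The sum over all pairs of adjacent entries of a list `u ++ a :: b :: v` of `g u a b v`. -/
def adjSum (g : List α → α → α → List α → N) (w : List α) : N :=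
  ∑ k : Fin w.length, ∑ k' : Fin w.length,
    if (k' : ℕ) = k + 1 then g (w.take k) (w.get k) (w.get k') (w.drop (k + 2)) else 0

variable (g : List α → α → α → List α → N)

@[simp] theorem adjSum_nil : adjSum g [] = 0 := rfl

@[simp] theorem adjSum_singleton (a : α) : adjSum g [a] = 0 := by simp [adjSum]

theorem adjSum_cons_cons (a b : α) (w : List α) :
    adjSum g (a :: b :: w) = g [] a b w + adjSum (fun u => g (a :: u)) (b :: w) := by
  simp [adjSum, Fin.sum_univ_succ (n := w.length + 1), Fin.sum_univ_succ (n := w.length)]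

theorem smul_adjSum {R : Type*} [Semiring R] [Module R N] (c : R) (w : List α) :
    c • adjSum g w = adjSum (fun u a b v => c • g u a b v) w := by
  simp only [adjSum, Finset.smul_sum, smul_ite, smul_zero]

theorem mul_adjSum {R : Type*} [NonUnitalNonAssocSemiring R] (c : R)
    (g : List α → α → α → List α → R) (w : List α) :
    c * adjSum g w = adjSum (fun u a b v => c * g u a b v) w := by
  simp only [adjSum, Finset.mul_sum, mul_ite, mul_zero]

theorem adjSum_ofFn {n : ℕ} (f : Fin n → α) : adjSum g (List.ofFn f) =
    ∑ k : Fin n, ∑ k' : Fin n, if (k' : ℕ) = k + 1 then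
      g ((List.ofFn f).take k) (f k) (f k') ((List.ofFn f).drop (k + 2)) else 0 :=
  Fintype.sum_equiv (finCongr List.length_ofFn) _ _ fun k =>
    Fintype.sum_equiv (finCongr List.length_ofFn) _ _ fun k' => by
      simp only [List.get_ofFn]
      rfl

end AdjacentSum

section ShuffleProd

variable {V : Type*} [AddCommGroup V] [Module ℝ V] {𝒱 : ℤ → Submodule ℝ V}

theorem shuffleProd_eq_shuffleSum (x y : List (Letter 𝒱)) :
    shuffleProd x y = shuffleSum (fun w => tens (w.map Prod.fst)) x y := by
  simp only [shuffleProd, shuffleSum, shuffleSumFam, List.map_ofFn]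
  rfl

variable (hV : DirectSum.IsInternal 𝒱)

theorem shuffleSum_tens (x y : List (Letter 𝒱)) :
    shuffleSum (fun w => tens (w.map Prod.fst)) x y = shuffleMap hV x (tens y) := by
  induction x generalizing y with
  | nil => simp [shuffleSum_nil, Function.comp_def]
  | cons a x ihx =>
    induction y with
    | nil => simp [shuffleSum_nil_right, Function.comp_def]
    | cons b y ihy =>
      simp only [shuffleSum_cons_cons, List.map_cons, tens_cons, shuffleSum_mul_left, ihx, ihy,
        shuffleMap_cons, degSum_cons]

theorem shuffleProd_eq_shuffleMap (x y : List (Letter 𝒱)) :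
    shuffleProd x y = shuffleMap hV x (tens y) := by
  rw [shuffleProd_eq_shuffleSum, shuffleSum_tens hV]

end ShuffleProd

namespace GerstenhaberAlgebra

variable {G : Type*} [AddCommGroup G] [Module ℝ G] (A : GerstenhaberAlgebra G)

theorem mulTens_eq_adjSum (w : List (Letter A.grade)) : A.mulTens w =
    adjSum (fun u a b v => koszul 1 (degSum u + letterDeg a) •
      (tens u * letterTens (A.mulLetter a b) * tens v)) w := by
  have hdeg (k : Fin w.length) :
      ((w.take (k + 1)).map letterDeg).sum = degSum (w.take k) + letterDeg (w.get k) := by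
    rw [List.take_add_one, degSum]
    simp
  simp only [mulTens, adjSum, hdeg, koszul_one_left]
  rfl

theorem mulTens_eq_mulMap (w : List (Letter A.grade)) : A.mulTens w = A.mulMap (tens w) := by
  rw [mulTens_eq_adjSum]
  induction w with
  | nil => simp
  | cons a w ih =>
    cases w with
    | nil => rw [tens_cons, mulMap_letterTens_mul]; simp
    | cons b w =>
      rw [adjSum_cons_cons, tens_cons, mulMap_letterTens_mul, ← ih, mul_adjSum, smul_add, tens_cons,
        headMul_letterTens_mul, smul_adjSum]
      congr 1
      · simp
      · congr 1
        ext u c d v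
        simp [smul_smul, _root_.mul_assoc, add_assoc, koszul_add_right]

/-- The contraction of the adjacent pairs of a marked word that come from different blocks. -/
def contract (w : List (Letter A.grade × Bool)) : TensorAlgebra ℝ G :=
  adjSum (fun u a b v => if a.2 = true ∧ b.2 = false then
    tens (u.map Prod.fst) * letterTens (A.bracketLetter a.1 b.1) * tens (v.map Prod.fst) else 0) w

/-- The bracket of `a`, taken from the first block, with the first letter of a marked word, if the
latter comes from the second block. -/
def contractHead (a : Letter A.grade) : List (Letter A.grade × Bool) → TensorAlgebra ℝ G
  | [] => 0
  | b :: w => if b.2 = false then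
      letterTens (A.bracketLetter a b.1) * tens (w.map Prod.fst) else 0

theorem contract_cons (a : Letter A.grade × Bool) (w : List (Letter A.grade × Bool)) :
    A.contract (a :: w) = (if a.2 = true then A.contractHead a.1 w else 0) +
      letterTens a.1 * A.contract w := by
  cases w with
  | nil => simp [contract, contractHead]
  | cons b w =>
    rw [contract, adjSum_cons_cons, contract, mul_adjSum]
    congr 1
    · by_cases h : a.2 = true <;> simp [contractHead, h]
    · congr 1
      ext u c d v
      split_ifs <;> simp [_root_.mul_assoc]

theorem contract_map_const (s : Bool) (x : List (Letter A.grade)) :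
    A.contract (x.map (·, s)) = 0 := by
  induction x with
  | nil => rfl
  | cons a x ih =>
    rw [List.map_cons, contract_cons, ih]
    cases x <;> cases s <;> simp [contractHead]

theorem bracketTens_eq_shuffleSum (x y : List (Letter A.grade)) :
    A.bracketTens x y = shuffleSum A.contract x y := by
  simp only [bracketTens, shuffleSum, shuffleSumFam, contract, adjSum_ofFn, List.map_take,
    List.map_drop, List.map_ofFn, Finset.smul_sum]
  refine Finset.sum_congr rfl fun σ _ => Finset.sum_congr rfl fun k _ =>
    Finset.sum_congr rfl fun k' _ => ?_
  simp only [decide_eq_true_eq, decide_eq_false_iff_not, not_lt, ite_and, smul_ite, smul_zero]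
  rfl

theorem shuffleSum_contractHead (a : Letter A.grade) (x : List (Letter A.grade))
    (b : Letter A.grade) (y : List (Letter A.grade)) :
    shuffleSum (A.contractHead a) x (b :: y) = koszul (degSum x) (letterDeg b) •
      (letterTens (A.bracketLetter a b) * shuffleMap A.isInternal x (tens y)) := by
  rw [← shuffleSum_tens, ← shuffleSum_mul_left]
  cases x with
  | nil => simp [shuffleSum_nil, contractHead]
  | cons c x => simp [shuffleSum_cons_cons, contractHead, shuffleSum_zero]

theorem bracketTens_eq_bracketMap (x y : List (Letter A.grade)) :
    A.bracketTens x y = A.bracketMap x (tens y) := by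
  rw [bracketTens_eq_shuffleSum]
  induction x generalizing y with
  | nil => rw [shuffleSum_nil, contract_map_const, bracketMap_nil]
  | cons a x ihx =>
    induction y with
    | nil => rw [shuffleSum_nil_right, contract_map_const, tens_nil, bracketMap_one]
    | cons b y ihy =>
      rw [shuffleSum_cons_cons]
      simp only [contract_cons, if_true, Bool.false_eq_true, if_false, zero_add]
      rw [shuffleSum_add, shuffleSum_mul_left, shuffleSum_mul_left, ihx, ihy,
        shuffleSum_contractHead, tens_cons, bracketMap_cons]
      abel_nf

end GerstenhaberAlgebra

section SpanExtension

variable {R I J E E' N : Type*} [CommRing R] [AddCommGroup E] [Module R E] [AddCommGroup E']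
  [Module R E'] [AddCommGroup N] [Module R N] {q : I → E} {q' : J → E'}

theorem exists_linearMap_of_span (hq : Submodule.span R (Set.range q) = ⊤) (g : I → N)
    (hg : ∀ c : I →₀ R, Finsupp.linearCombination R q c = 0 →
      Finsupp.linearCombination R g c = 0) :
    ∃ φ : E →ₗ[R] N, ∀ i, φ (q i) = g i := by
  have hsurj : Function.Surjective (Finsupp.linearCombination R q) := by
    rw [← LinearMap.range_eq_top, Finsupp.range_linearCombination, hq]
  let e := (Finsupp.linearCombination R q).quotKerEquivOfSurjective hsurj
  have he (i : I) : e.symm (q i) = Submodule.Quotient.mk (Finsupp.single i 1) := by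
    rw [LinearEquiv.symm_apply_eq]
    simp [e]
  refine ⟨Submodule.liftQ _ (Finsupp.linearCombination R g) (fun c hc => hg c hc) ∘ₗ
    e.symm.toLinearMap, fun i => ?_⟩
  rw [LinearMap.comp_apply, LinearEquiv.coe_coe, he]
  exact (Submodule.liftQ_apply _ _ _).trans (by simp)

theorem exists_bilinear_of_span (hq : Submodule.span R (Set.range q) = ⊤)
    (hq' : Submodule.span R (Set.range q') = ⊤) (f : I → J → N)
    (hright : ∀ i, ∃ φ : E' →ₗ[R] N, ∀ j, φ (q' j) = f i j)
    (hleft : ∀ j, ∃ φ : E →ₗ[R] N, ∀ i, φ (q i) = f i j) :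
    ∃ B : E →ₗ[R] E' →ₗ[R] N, ∀ i j, B (q i) (q' j) = f i j := by
  choose φ hφ using hright
  choose ψ hψ using hleft
  obtain ⟨B, hB⟩ := exists_linearMap_of_span hq φ fun c hc => by
    refine LinearMap.ext_on_range hq' fun j => ?_
    have hψc := congrArg (ψ j) hc
    simp only [Finsupp.linearCombination_apply, Finsupp.sum, map_sum, map_smul, hψ,
      map_zero] at hψc
    simpa [Finsupp.linearCombination_apply, Finsupp.sum, hφ] using hψc
  exact ⟨B, fun i j => by rw [hB, hφ]⟩

end SpanExtension

section HomogeneousTensors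

variable {V D : Type*} [AddCommGroup V] [Module ℝ V] {𝒱 : ℤ → Submodule ℝ V} [AddCommMonoid D]

/-- The words whose letters have degrees, in the sense of the relation `r`, of given sum.  Degrees
are a relation, because a letter of `G ⋉ M` may be inhomogeneous for the number of factors from
`M`, and because zero letters have several degrees. -/
inductive WordHasDeg (r : Letter 𝒱 → D → Prop) : List (Letter 𝒱) → D → Prop
  | nil : WordHasDeg r [] 0
  | cons {a : Letter 𝒱} {w : List (Letter 𝒱)} {δ ε : D} :
      r a δ → WordHasDeg r w ε → WordHasDeg r (a :: w) (δ + ε)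

/-- The tensors that are homogeneous of degree `δ` for the letter degrees `r`. -/
def homTens (r : Letter 𝒱 → D → Prop) (δ : D) : Submodule ℝ (TensorAlgebra ℝ V) :=
  Submodule.span ℝ (tens '' {w | WordHasDeg r w δ})

variable {r : Letter 𝒱 → D → Prop} {δ ε : D}

theorem tens_mem_homTens {w : List (Letter 𝒱)} (h : WordHasDeg r w δ) : tens w ∈ homTens r δ :=
  Submodule.subset_span ⟨w, h, rfl⟩

theorem map_mem_of_mem_homTens {N : Type*} [AddCommGroup N] [Module ℝ N]
    (f : TensorAlgebra ℝ V →ₗ[ℝ] N) {K : Submodule ℝ N}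
    (h : ∀ w, WordHasDeg r w δ → f (tens w) ∈ K) {t : TensorAlgebra ℝ V} (ht : t ∈ homTens r δ) :
    f t ∈ K :=
  (Submodule.span_le (p := K.comap f)).2 (Set.image_subset_iff.2 h) ht

theorem letterTens_mul_mem_homTens {a : Letter 𝒱} (ha : r a δ) {t : TensorAlgebra ℝ V}
    (ht : t ∈ homTens r ε) : letterTens a * t ∈ homTens r (δ + ε) :=
  map_mem_of_mem_homTens (LinearMap.mulLeft ℝ (letterTens a))
    (fun _ hw => tens_mem_homTens (.cons ha hw)) ht

theorem shuffleMap_mem_homTens (hV : DirectSum.IsInternal 𝒱) {x : List (Letter 𝒱)}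
    (hx : WordHasDeg r x δ) {t : TensorAlgebra ℝ V} (ht : t ∈ homTens r ε) :
    shuffleMap hV x t ∈ homTens r (δ + ε) := by
  refine map_mem_of_mem_homTens _ (fun y hy => ?_) ht
  clear ht
  induction hx generalizing y ε with
  | nil => rw [zero_add]; exact tens_mem_homTens hy
  | @cons a x δ₁ δ₂ ha hx ihx =>
    induction hy with
    | nil => rw [add_zero, tens_nil, shuffleMap_one]; exact tens_mem_homTens (.cons ha hx)
    | @cons b y ε₁ ε₂ hb hy ihy =>
      have head_left := letterTens_mul_mem_homTens ha (ihx _ (.cons hb hy))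
      have head_right := letterTens_mul_mem_homTens hb ihy
      rw [tens_cons] at head_left ⊢
      rw [shuffleMap_cons]
      refine add_mem ?_ (Submodule.smul_mem _ _ ?_)
      · rwa [add_assoc]
      · rwa [add_left_comm]

theorem wordHasDeg_degSum (w : List (Letter 𝒱)) : WordHasDeg (letterDeg · = ·) w (degSum w) := by
  induction w with
  | nil => exact .nil
  | cons a w ih => exact .cons rfl ih

theorem WordHasDeg.degSum_eq {w : List (Letter 𝒱)} {d : ℤ}
    (h : WordHasDeg (letterDeg · = ·) w d) : degSum w = d := by
  induction h with
  | nil => rfl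
  | cons ha _ ih => rw [degSum_cons, ha, ih]

variable (hV : DirectSum.IsInternal 𝒱) (d : ℤ)

/-- The extension of `signTwist` to tensors, `t ↦ (-1)^(d * deg t) t`. -/
def degTwist : TensorAlgebra ℝ V →ₐ[ℝ] TensorAlgebra ℝ V :=
  TensorAlgebra.lift ℝ (TensorAlgebra.ι ℝ ∘ₗ signTwist hV d)

theorem degTwist_tens (w : List (Letter 𝒱)) :
    degTwist hV d (tens w) = koszul d (degSum w) • tens w := by
  induction w with
  | nil => simp
  | cons a w ih =>
    rw [tens_cons, map_mul, ih, degTwist, letterTens, TensorAlgebra.lift_ι_apply,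
      LinearMap.comp_apply, signTwist_letter, map_smul, smul_mul_smul_comm, degSum_cons,
      koszul_add_right]

theorem degTwist_of_mem_homTens {e : ℤ} {t : TensorAlgebra ℝ V}
    (ht : t ∈ homTens (𝒱 := 𝒱) (letterDeg · = ·) e) : degTwist hV d t = koszul d e • t := by
  have hsub := map_mem_of_mem_homTens ((degTwist hV d).toLinearMap - koszul d e • LinearMap.id)
    (K := ⊥) (fun w hw => by simp [degTwist_tens, hw.degSum_eq]) ht
  simpa [sub_eq_zero] using hsub

end HomogeneousTensors

section ShuffleQuotient

variable {V : Type*} [AddCommGroup V] [Module ℝ V] {𝒱 : ℤ → Submodule ℝ V}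

theorem degSum_eq_wordDeg_add_one (w : List (Letter 𝒱)) : degSum w = wordDeg w + 1 :=
  (sub_add_cancel _ _).symm

/-- The class in `𝓗` of a word. -/
def wordClass (w : List (Letter 𝒱)) : ShuffleQuot 𝒱 := (shuffleRel 𝒱).mkQ (tens w)

theorem mkQ_tens (w : List (Letter 𝒱)) : (shuffleRel 𝒱).mkQ (tens w) = wordClass w := rfl

@[simp] theorem wordClass_nil : wordClass ([] : List (Letter 𝒱)) = 0 :=
  (Submodule.Quotient.mk_eq_zero _).2 (Submodule.subset_span (Or.inl rfl))

theorem span_range_wordClass (hV : DirectSum.IsInternal 𝒱) :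
    Submodule.span ℝ (Set.range (wordClass (𝒱 := 𝒱))) = ⊤ := by
  rw [show wordClass (𝒱 := 𝒱) = (shuffleRel 𝒱).mkQ ∘ tens from rfl, Set.range_comp,
    Submodule.span_image, span_range_tens hV, Submodule.map_top, Submodule.range_mkQ]

theorem algebraMapInv_letterTens (a : Letter 𝒱) :
    TensorAlgebra.algebraMapInv (letterTens a) = (0 : ℝ) := by
  simp [TensorAlgebra.algebraMapInv, letterTens]

/-- On tensors `t` of positive length, this says that shuffle products vanish in `𝓗`. -/
theorem mkQ_shuffleMap (hV : DirectSum.IsInternal 𝒱) {x : List (Letter 𝒱)} (hx : x ≠ [])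
    (t : TensorAlgebra ℝ V) : (shuffleRel 𝒱).mkQ (shuffleMap hV x t) =
      (TensorAlgebra.algebraMapInv t : ℝ) • wordClass x := by
  refine LinearMap.congr_fun (f := (shuffleRel 𝒱).mkQ ∘ₗ shuffleMap hV x)
    (g := TensorAlgebra.algebraMapInv.toLinearMap.smulRight (wordClass x))
    (tensorAlgebra_linearMap_ext hV fun y => ?_) t
  rw [LinearMap.comp_apply, LinearMap.smulRight_apply, AlgHom.toLinearMap_apply]
  cases y with
  | nil => simp [wordClass]
  | cons b y =>
    rw [← shuffleProd_eq_shuffleMap, tens_cons, map_mul, algebraMapInv_letterTens, zero_mul,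
      zero_smul, Submodule.mkQ_apply, Submodule.Quotient.mk_eq_zero]
    exact Submodule.subset_span (Or.inr ⟨x, _, hx, List.cons_ne_nil b y, rfl⟩)

theorem shuffleRel_le_comap (hV : DirectSum.IsInternal 𝒱) {N : Type*} [AddCommGroup N]
    [Module ℝ N] (f : TensorAlgebra ℝ V →ₗ[ℝ] N) {K : Submodule ℝ N} (hone : f 1 ∈ K)
    (hshuffle : ∀ x y : List (Letter 𝒱), x ≠ [] → y ≠ [] → f (shuffleMap hV x (tens y)) ∈ K) :
    shuffleRel 𝒱 ≤ K.comap f := by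
  refine Submodule.span_le.2 ?_
  rintro _ (rfl | ⟨x, y, hx, hy, rfl⟩)
  · exact hone
  · rw [shuffleProd_eq_shuffleMap hV]; exact hshuffle x y hx hy

theorem shuffleRel_le_comap_degTwist (hV : DirectSum.IsInternal 𝒱) (d : ℤ) :
    shuffleRel 𝒱 ≤ (shuffleRel 𝒱).comap (degTwist hV d).toLinearMap := by
  refine shuffleRel_le_comap hV _ ?_ fun x y hx hy => ?_
  · rw [AlgHom.toLinearMap_apply, map_one]
    exact Submodule.subset_span (Or.inl rfl)
  · rw [AlgHom.toLinearMap_apply, degTwist_of_mem_homTens hV d (shuffleMap_mem_homTens hV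
      (wordHasDeg_degSum x) (tens_mem_homTens (wordHasDeg_degSum y))), ← shuffleProd_eq_shuffleMap]
    exact Submodule.smul_mem _ _ (Submodule.subset_span (Or.inr ⟨x, y, hx, hy, rfl⟩))

/-- The operator `X ↦ (-1)^(d * deg X) X` on `𝓗[1]`. -/
def twistClass (hV : DirectSum.IsInternal 𝒱) (d : ℤ) : ShuffleQuot 𝒱 →ₗ[ℝ] ShuffleQuot 𝒱 :=
  koszul d 1 • Submodule.mapQ _ _ (degTwist hV d).toLinearMap (shuffleRel_le_comap_degTwist hV d)

theorem twistClass_wordClass (hV : DirectSum.IsInternal 𝒱) (d : ℤ) (w : List (Letter 𝒱)) :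
    twistClass hV d (wordClass w) = koszul d (wordDeg w) • wordClass w := by
  rw [twistClass, wordClass, LinearMap.smul_apply, Submodule.mkQ_apply, Submodule.mapQ_apply,
    AlgHom.toLinearMap_apply, degTwist_tens, Submodule.Quotient.mk_smul, smul_smul,
    degSum_eq_wordDeg_add_one]
  congr 1
  grind

/-- The classes in `𝓗` of the tensors that are homogeneous of degree `δ` for the letter
degrees `r`. -/
def homClass {D : Type*} [AddCommMonoid D] (r : Letter 𝒱 → D → Prop) (δ : D) :
    Submodule ℝ (ShuffleQuot 𝒱) := (homTens r δ).map (shuffleRel 𝒱).mkQ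

theorem map_mem_of_mem_homClass {D : Type*} [AddCommMonoid D] {r : Letter 𝒱 → D → Prop} {δ : D}
    {N : Type*} [AddCommGroup N] [Module ℝ N] (f : ShuffleQuot 𝒱 →ₗ[ℝ] N) {K : Submodule ℝ N}
    (h : ∀ w, WordHasDeg r w δ → f (wordClass w) ∈ K) {t : ShuffleQuot 𝒱} (ht : t ∈ homClass r δ) :
    f t ∈ K := by
  obtain ⟨t, ht, rfl⟩ := ht
  exact map_mem_of_mem_homTens (f ∘ₗ (shuffleRel 𝒱).mkQ) h ht

variable (𝒱) in
/-- The component of degree `e` of `𝓗[1]`, for the degree `wordDeg`. -/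
def degClass (e : ℤ) : Submodule ℝ (ShuffleQuot 𝒱) := homClass (letterDeg · = ·) (e + 1)

theorem wordClass_mem_degClass (w : List (Letter 𝒱)) : wordClass w ∈ degClass 𝒱 (wordDeg w) := by
  rw [degClass, ← degSum_eq_wordDeg_add_one]
  exact Submodule.mem_map_of_mem (tens_mem_homTens (wordHasDeg_degSum w))

theorem eq_of_mem_degClass {e : ℤ} {N : Type*} [AddCommGroup N] [Module ℝ N]
    (f g : ShuffleQuot 𝒱 →ₗ[ℝ] N) (h : ∀ w, wordDeg w = e → f (wordClass w) = g (wordClass w))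
    {t : ShuffleQuot 𝒱} (ht : t ∈ degClass 𝒱 e) : f t = g t := by
  have hsub : (f - g) t ∈ (⊥ : Submodule ℝ N) := map_mem_of_mem_homClass _ (fun w hw => by
    have hdeg := hw.degSum_eq
    rw [degSum_eq_wordDeg_add_one, add_left_inj] at hdeg
    simp [h w hdeg]) ht
  simpa [sub_eq_zero] using hsub

theorem twistClass_of_mem_degClass (hV : DirectSum.IsInternal 𝒱) (d : ℤ) {e : ℤ}
    {h : ShuffleQuot 𝒱} (hh : h ∈ degClass 𝒱 e) : twistClass hV d h = koszul d e • h :=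
  eq_of_mem_degClass (twistClass hV d) (koszul d e • LinearMap.id)
    (fun w hw => by simp [twistClass_wordClass, hw]) hh

end ShuffleQuotient

namespace GerstenhaberAlgebra

variable {G D : Type*} [AddCommGroup G] [Module ℝ G] (A : GerstenhaberAlgebra G)

theorem algebraMapInv_mulMap (t : TensorAlgebra ℝ G) :
    TensorAlgebra.algebraMapInv (A.mulMap t) = (0 : ℝ) := by
  refine LinearMap.congr_fun (f := TensorAlgebra.algebraMapInv.toLinearMap ∘ₗ A.mulMap) (g := 0)
    (tensorAlgebra_linearMap_ext A.isInternal fun w => ?_) t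
  rw [LinearMap.comp_apply, AlgHom.toLinearMap_apply, LinearMap.zero_apply]
  rcases w with _ | ⟨a, _ | ⟨b, w⟩⟩
  · simp
  all_goals
    rw [tens_cons, mulMap_letterTens_mul]
    simp [algebraMapInv_letterTens]

theorem algebraMapInv_bracketMap (x : List (Letter A.grade)) (t : TensorAlgebra ℝ G) :
    TensorAlgebra.algebraMapInv (A.bracketMap x t) = (0 : ℝ) := by
  refine LinearMap.congr_fun (f := TensorAlgebra.algebraMapInv.toLinearMap ∘ₗ A.bracketMap x)
    (g := 0) (tensorAlgebra_linearMap_ext A.isInternal fun y => ?_) t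
  rcases x with _ | ⟨a, x⟩ <;> rcases y with _ | ⟨b, y⟩ <;>
    simp [bracketMap_cons, algebraMapInv_letterTens]

theorem shuffleRel_le_comap_mulMap : shuffleRel A.grade ≤ (shuffleRel A.grade).comap A.mulMap := by
  refine shuffleRel_le_comap A.isInternal _ (by simp) fun x y hx hy => ?_
  rw [← Submodule.ker_mkQ (shuffleRel A.grade), LinearMap.mem_ker, mulMap_shuffleMap, map_add,
    map_smul, map_smul, mkQ_shuffleMap _ hx, mkQ_shuffleMap _ hy]
  simp [algebraMapInv_mulMap]

theorem shuffleRel_le_comap_bracketMap (z : List (Letter A.grade)) :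
    shuffleRel A.grade ≤ (shuffleRel A.grade).comap (A.bracketMap z) := by
  refine shuffleRel_le_comap A.isInternal _ (by simp) fun x y hx hy => ?_
  rw [← Submodule.ker_mkQ (shuffleRel A.grade), LinearMap.mem_ker, bracketMap_shuffleMap, map_add,
    map_smul, map_smul, mkQ_shuffleMap _ hx, mkQ_shuffleMap _ hy]
  simp [algebraMapInv_bracketMap]

/-- The operator induced on `𝓗` by the product, see `mulTens`. -/
def mulClass : ShuffleQuot A.grade →ₗ[ℝ] ShuffleQuot A.grade :=
  Submodule.mapQ _ _ A.mulMap A.shuffleRel_le_comap_mulMap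

/-- The operator induced on `𝓗` by `bracketMap x`, without the sign of `lieClass`. -/
def bracketClass (x : List (Letter A.grade)) : ShuffleQuot A.grade →ₗ[ℝ] ShuffleQuot A.grade :=
  Submodule.mapQ _ _ (A.bracketMap x) (A.shuffleRel_le_comap_bracketMap x)

theorem mulClass_mkQ (t : TensorAlgebra ℝ G) :
    A.mulClass ((shuffleRel A.grade).mkQ t) = (shuffleRel A.grade).mkQ (A.mulMap t) := rfl

theorem bracketClass_mkQ (x : List (Letter A.grade)) (t : TensorAlgebra ℝ G) :
    A.bracketClass x ((shuffleRel A.grade).mkQ t) = (shuffleRel A.grade).mkQ (A.bracketMap x t) :=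
  rfl

theorem bracketClass_antisymm (x y : List (Letter A.grade)) :
    A.bracketClass x (wordClass y) =
      (-koszul (degSum x) (degSum y)) • A.bracketClass y (wordClass x) := by
  rw [wordClass, wordClass, bracketClass_mkQ, bracketMap_antisymm, map_smul, bracketClass_mkQ]

theorem exists_lieClass : ∃ B : ShuffleQuot A.grade →ₗ[ℝ] ShuffleQuot A.grade →ₗ[ℝ]
    ShuffleQuot A.grade, ∀ x y : List (Letter A.grade),
      B (wordClass x) (wordClass y) = koszul 1 (wordDeg x) • A.bracketClass x (wordClass y) := by
  refine exists_bilinear_of_span (span_range_wordClass A.isInternal)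
    (span_range_wordClass A.isInternal) _ (fun x => ⟨koszul 1 (wordDeg x) • A.bracketClass x,
      fun y => rfl⟩) (fun y => ⟨koszul 1 (wordDeg y) • A.bracketClass y ∘ₗ
        twistClass A.isInternal (wordDeg y), fun x => ?_⟩)
  rw [LinearMap.smul_apply, LinearMap.comp_apply, twistClass_wordClass, map_smul,
    bracketClass_antisymm A x y, smul_smul, smul_smul, degSum_eq_wordDeg_add_one,
    degSum_eq_wordDeg_add_one]
  congr 1
  grind

/-- The bracket `ℓ` on `𝓗[1]`. -/
def lieClass : ShuffleQuot A.grade →ₗ[ℝ] ShuffleQuot A.grade →ₗ[ℝ] ShuffleQuot A.grade :=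
  A.exists_lieClass.choose

theorem lieClass_wordClass (x : List (Letter A.grade)) (h : ShuffleQuot A.grade) :
    A.lieClass (wordClass x) h = koszul 1 (wordDeg x) • A.bracketClass x h :=
  LinearMap.congr_fun (g := koszul 1 (wordDeg x) • A.bracketClass x)
    (LinearMap.ext_on_range (span_range_wordClass A.isInternal)
      (A.exists_lieClass.choose_spec x)) h

theorem lieClass_comm {e e' : ℤ} {h k : ShuffleQuot A.grade} (hh : h ∈ degClass A.grade e)
    (hk : k ∈ degClass A.grade e') : A.lieClass h k = koszul e e' • A.lieClass k h := by
  refine eq_of_mem_degClass (A.lieClass.flip k) (koszul e e' • A.lieClass k) (fun x hx => ?_) hh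
  refine eq_of_mem_degClass (A.lieClass (wordClass x))
    (koszul e e' • A.lieClass.flip (wordClass x)) (fun y hy => ?_) hk
  rw [LinearMap.smul_apply, LinearMap.flip_apply, lieClass_wordClass, lieClass_wordClass,
    bracketClass_antisymm, smul_smul, smul_smul, degSum_eq_wordDeg_add_one,
    degSum_eq_wordDeg_add_one, hx, hy]
  congr 1
  grind

theorem mulClass_mulClass (h : ShuffleQuot A.grade) : A.mulClass (A.mulClass h) = 0 := by
  obtain ⟨t, rfl⟩ := Submodule.mkQ_surjective _ h
  rw [mulClass_mkQ, mulClass_mkQ, mulMap_mulMap, map_zero]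

section Degree

variable [AddCommMonoid D] {r : Letter A.grade → D → Prop} {δ ε μ : D}

theorem bracketMap_mem_homTens
    (hr : ∀ {a b : Letter A.grade} {δ ε : D}, r a δ → r b ε → r (A.bracketLetter a b) (δ + ε + μ))
    {x : List (Letter A.grade)} (hx : WordHasDeg r x δ) {t : TensorAlgebra ℝ G}
    (ht : t ∈ homTens r ε) : A.bracketMap x t ∈ homTens r (δ + ε + μ) := by
  refine map_mem_of_mem_homTens _ (fun y hy => ?_) ht
  clear ht
  induction hx generalizing y ε with
  | nil => simp
  | @cons a x δ₁ δ₂ ha hx ihx =>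
    induction hy with
    | nil => simp
    | @cons b y ε₁ ε₂ hb hy ihy =>
      have head_left := letterTens_mul_mem_homTens ha (ihx _ (.cons hb hy))
      have head_right := letterTens_mul_mem_homTens hb ihy
      have head_bracket := letterTens_mul_mem_homTens (hr ha hb)
        (shuffleMap_mem_homTens A.isInternal hx (tens_mem_homTens hy))
      rw [tens_cons] at head_left ⊢
      rw [bracketMap_cons]
      refine add_mem (add_mem ?_ (Submodule.smul_mem _ _ ?_)) (Submodule.smul_mem _ _ ?_)
      · convert head_left using 2; abel
      · convert head_right using 2; abel
      · convert head_bracket using 2; abel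

theorem mulMap_mem_homTens
    (hr : ∀ {a b : Letter A.grade} {δ ε : D}, r a δ → r b ε → r (A.mulLetter a b) (δ + ε + μ))
    {t : TensorAlgebra ℝ G} (ht : t ∈ homTens r δ) : A.mulMap t ∈ homTens r (δ + μ) := by
  refine map_mem_of_mem_homTens _ (fun y hy => ?_) ht
  clear ht
  induction hy with
  | nil => simp
  | @cons a x δ₁ δ₂ ha hx ih =>
    have tail_mul := letterTens_mul_mem_homTens ha ih
    rw [tens_cons, mulMap_letterTens_mul]
    refine Submodule.smul_mem _ _ (add_mem ?_ (by rwa [add_assoc]))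
    cases hx with
    | nil => simp
    | cons hb hx =>
      rw [tens_cons, headMul_letterTens_mul]
      convert letterTens_mul_mem_homTens (hr ha hb) (tens_mem_homTens hx) using 2
      abel

theorem mulClass_mem_homClass
    (hr : ∀ {a b : Letter A.grade} {δ ε : D}, r a δ → r b ε → r (A.mulLetter a b) (δ + ε + μ))
    {h : ShuffleQuot A.grade} (hh : h ∈ homClass r δ) : A.mulClass h ∈ homClass r (δ + μ) := by
  obtain ⟨t, ht, rfl⟩ := hh
  exact Submodule.mem_map_of_mem (A.mulMap_mem_homTens hr ht)

theorem lieClass_mem_homClass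
    (hr : ∀ {a b : Letter A.grade} {δ ε : D}, r a δ → r b ε → r (A.bracketLetter a b) (δ + ε + μ))
    {h k : ShuffleQuot A.grade} (hh : h ∈ homClass r δ) (hk : k ∈ homClass r ε) :
    A.lieClass h k ∈ homClass r (δ + ε + μ) := by
  refine map_mem_of_mem_homClass (A.lieClass.flip k) (fun x hx => ?_) hh
  obtain ⟨t, ht, rfl⟩ := hk
  rw [LinearMap.flip_apply, lieClass_wordClass, bracketClass_mkQ]
  exact Submodule.smul_mem _ _ (Submodule.mem_map_of_mem (A.bracketMap_mem_homTens hr hx ht))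

end Degree

theorem mulClass_mem_degClass {e : ℤ} {h : ShuffleQuot A.grade} (hh : h ∈ degClass A.grade e) :
    A.mulClass h ∈ degClass A.grade (e + 1) :=
  A.mulClass_mem_homClass (by rintro a b _ _ rfl rfl; simp) hh

theorem lieClass_mem_degClass {e e' : ℤ} {h k : ShuffleQuot A.grade}
    (hh : h ∈ degClass A.grade e) (hk : k ∈ degClass A.grade e') :
    A.lieClass h k ∈ degClass A.grade (e + e' + 1) := by
  rw [degClass, show e + e' + 1 + 1 = e + 1 + (e' + 1) + 0 by ring]
  exact A.lieClass_mem_homClass (by rintro a b _ _ rfl rfl; simp) hh hk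

theorem mulClass_lieClass (x y : List (Letter A.grade)) :
    A.mulClass (A.lieClass (wordClass x) (wordClass y)) +
      A.lieClass (A.mulClass (wordClass x)) (wordClass y) +
      koszul 1 (wordDeg x) • A.lieClass (wordClass x) (A.mulClass (wordClass y)) = 0 := by
  have hderiv := congrArg (shuffleRel A.grade).mkQ (A.mulMap_bracketMap x y)
  simp only [map_add, map_smul, ← bracketClass_mkQ, ← mulClass_mkQ, mkQ_tens] at hderiv
  rw [A.lieClass_comm (A.mulClass_mem_degClass (wordClass_mem_degClass x))
    (wordClass_mem_degClass y)]
  simp only [lieClass_wordClass, map_smul, hderiv, smul_add, smul_smul, degSum_eq_wordDeg_add_one,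
    koszul_add_left, koszul_add_right, koszul_one_one]
  match_scalars <;> grind

theorem lieClass_jacobi (x y z : List (Letter A.grade)) :
    A.lieClass (A.lieClass (wordClass x) (wordClass y)) (wordClass z) +
      koszul (wordDeg x + 1) (wordDeg y) •
        A.lieClass (wordClass y) (A.lieClass (wordClass x) (wordClass z)) +
      koszul 1 (wordDeg x) •
        A.lieClass (wordClass x) (A.lieClass (wordClass y) (wordClass z)) = 0 := by
  have hjacobi := congrArg (shuffleRel A.grade).mkQ (A.bracketMap_jacobi x y z)
  simp only [map_add, map_smul, ← bracketClass_mkQ, mkQ_tens] at hjacobi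
  rw [A.lieClass_comm (A.lieClass_mem_degClass (wordClass_mem_degClass x)
    (wordClass_mem_degClass y)) (wordClass_mem_degClass z)]
  simp only [lieClass_wordClass, map_smul]
  rw [A.bracketClass_antisymm x z, map_smul, hjacobi]
  simp only [smul_add, smul_smul, degSum_eq_wordDeg_add_one, koszul_add_left, koszul_add_right,
    koszul_one_one]
  match_scalars <;> grind

end GerstenhaberAlgebra

section SymRec

variable {V N : Type*} [AddCommGroup V] [Module ℝ V] {𝒱 : ℤ → Submodule ℝ V}
  [AddCommGroup N] [Module ℝ N]

/-- The inclusion of `𝓗[1]` in the symmetric algebra. -/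
def symι (𝒱 : ℤ → Submodule ℝ V) : ShuffleQuot 𝒱 →ₗ[ℝ] SymH 𝒱 :=
  (RingQuot.mkAlgHom ℝ (symRel 𝒱)).toLinearMap ∘ₗ TensorAlgebra.ι ℝ

theorem proj_eq_symι_mkQ (t : TensorAlgebra ℝ V) :
    proj 𝒱 t = symι 𝒱 ((shuffleRel 𝒱).mkQ t) := rfl

@[simp] theorem symProd_nil : symProd ([] : List (List (Letter 𝒱))) = 1 := rfl

@[simp] theorem symProd_cons (x : List (Letter 𝒱)) (X : List (List (Letter 𝒱))) :
    symProd (x :: X) = symι 𝒱 (wordClass x) * symProd X := by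
  simp [symProd, proj_eq_symι_mkQ, wordClass]

theorem symProd_append (X Y : List (List (Letter 𝒱))) :
    symProd (X ++ Y) = symProd X * symProd Y := by
  simp [symProd]

theorem symι_wordClass_comm (x y : List (Letter 𝒱)) :
    symι 𝒱 (wordClass x) * symι 𝒱 (wordClass y) =
      koszul (wordDeg x) (wordDeg y) • (symι 𝒱 (wordClass y) * symι 𝒱 (wordClass x)) := by
  have hrel := RingQuot.mkAlgHom_rel ℝ (s := symRel 𝒱) ⟨x, y, rfl, rfl⟩
  simpa [symι, wordClass, koszul] using hrel

theorem symι_comm {e e' : ℤ} {h k : ShuffleQuot 𝒱} (hh : h ∈ degClass 𝒱 e)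
    (hk : k ∈ degClass 𝒱 e') : symι 𝒱 h * symι 𝒱 k = koszul e e' • (symι 𝒱 k * symι 𝒱 h) := by
  refine eq_of_mem_degClass (LinearMap.mulRight ℝ (symι 𝒱 k) ∘ₗ symι 𝒱)
    (koszul e e' • (LinearMap.mulLeft ℝ (symι 𝒱 k) ∘ₗ symι 𝒱)) (fun x hx => ?_) hh
  refine eq_of_mem_degClass (LinearMap.mulLeft ℝ (symι 𝒱 (wordClass x)) ∘ₗ symι 𝒱)
    (koszul e e' • (LinearMap.mulRight ℝ (symι 𝒱 (wordClass x)) ∘ₗ symι 𝒱)) (fun y hy => ?_) hk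
  simp [symι_wordClass_comm x y, hx, hy]

theorem symι_left_comm {e e' : ℤ} {h k : ShuffleQuot 𝒱} (hh : h ∈ degClass 𝒱 e)
    (hk : k ∈ degClass 𝒱 e') (s : SymH 𝒱) :
    symι 𝒱 h * (symι 𝒱 k * s) = koszul e e' • (symι 𝒱 k * (symι 𝒱 h * s)) := by
  rw [← mul_assoc, symι_comm hh hk, smul_mul_assoc, mul_assoc]

theorem adjoin_range_symι : Algebra.adjoin ℝ (Set.range (symι 𝒱)) = ⊤ := by
  rw [symι, LinearMap.coe_comp, Set.range_comp, AlgHom.coe_toLinearMap, ← AlgHom.map_adjoin,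
    TensorAlgebra.adjoin_range_ι, Algebra.map_top, AlgHom.range_eq_top]
  exact RingQuot.mkAlgHom_surjective ℝ (symRel 𝒱)

theorem span_range_symProd (hV : DirectSum.IsInternal 𝒱) :
    Submodule.span ℝ (Set.range (symProd (𝒱 := 𝒱))) = ⊤ := by
  refine span_range_prod_map_eq_top ?_
  change Algebra.adjoin ℝ (Set.range (symι 𝒱 ∘ wordClass)) = ⊤
  rw [← Algebra.adjoin_span, Set.range_comp, ← Submodule.map_span, span_range_wordClass hV,
    Submodule.map_top, LinearMap.coe_range, adjoin_range_symι]

theorem symH_linearMap_ext (hV : DirectSum.IsInternal 𝒱) {f g : SymH 𝒱 →ₗ[ℝ] N}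
    (h : ∀ X : List (List (Letter 𝒱)), f (symProd X) = g (symProd X)) : f = g :=
  LinearMap.ext_on_range (span_range_symProd hV) h

theorem symH_linearMap_ext_of_mul (hV : DirectSum.IsInternal 𝒱) {f g : SymH 𝒱 →ₗ[ℝ] N}
    (one : f 1 = g 1) (mul : ∀ (x : List (Letter 𝒱)) (s : SymH 𝒱), f s = g s →
      f (symι 𝒱 (wordClass x) * s) = g (symι 𝒱 (wordClass x) * s)) : f = g :=
  symH_linearMap_ext hV fun X => by
    induction X with
    | nil => exact one
    | cons x X ih => rw [symProd_cons]; exact mul x _ ih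

/-- The condition for the recursion rule `F (h · s) = β h s + γ h (F s)` to respect the graded
commutativity of the symmetric algebra. -/
def SymCompatible (β : ShuffleQuot 𝒱 →ₗ[ℝ] SymH 𝒱 →ₗ[ℝ] N)
    (γ : ShuffleQuot 𝒱 →ₗ[ℝ] N →ₗ[ℝ] N) : Prop :=
  ∀ (x y : List (Letter 𝒱)) (s : SymH 𝒱) (n : N),
    β (wordClass x) (symι 𝒱 (wordClass y) * s) +
        γ (wordClass x) (β (wordClass y) s + γ (wordClass y) n) =
      koszul (wordDeg x) (wordDeg y) • (β (wordClass y) (symι 𝒱 (wordClass x) * s) +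
        γ (wordClass y) (β (wordClass x) s + γ (wordClass x) n))

variable (n₀ : N) {β : ShuffleQuot 𝒱 →ₗ[ℝ] SymH 𝒱 →ₗ[ℝ] N} {γ : ShuffleQuot 𝒱 →ₗ[ℝ] N →ₗ[ℝ] N}

/-- The representation of the symmetric algebra underlying `symRec`. -/
def symRep (hc : SymCompatible β γ) : SymH 𝒱 →ₐ[ℝ] Module.End ℝ (SymH 𝒱 × N) :=
  RingQuot.liftAlgHom ℝ ⟨TensorAlgebra.lift ℝ (recStep (symι 𝒱) β γ), by
    rintro _ _ ⟨x, y, rfl, rfl⟩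
    refine LinearMap.ext fun ⟨s, n⟩ => ?_
    simp only [map_mul, map_smul, TensorAlgebra.lift_ι_apply, Module.End.mul_apply,
      LinearMap.smul_apply, recStep_apply, Prod.smul_mk, Prod.mk.injEq]
    exact ⟨symι_left_comm (wordClass_mem_degClass x) (wordClass_mem_degClass y) s, hc x y s n⟩⟩

/-- The linear map `F` on the symmetric algebra with `F 1 = n₀` and
`F (h · s) = β h s + γ h (F s)`. -/
def symRec (hc : SymCompatible β γ) : SymH 𝒱 →ₗ[ℝ] N :=
  LinearMap.snd ℝ _ _ ∘ₗ LinearMap.applyₗ (R := ℝ) ((1, n₀) : SymH 𝒱 × N) ∘ₗ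
    (symRep hc).toLinearMap

theorem symRep_symι (hc : SymCompatible β γ) (h : ShuffleQuot 𝒱) :
    symRep hc (symι 𝒱 h) = recStep (symι 𝒱) β γ h := by
  simp only [symRep, symι, LinearMap.comp_apply, AlgHom.toLinearMap_apply,
    RingQuot.liftAlgHom_mkAlgHom_apply, TensorAlgebra.lift_ι_apply]

theorem symRec_one (hc : SymCompatible β γ) : symRec n₀ hc 1 = n₀ := by
  simp [symRec]

theorem symRec_symι_mul (hc : SymCompatible β γ) (h : ShuffleQuot 𝒱) (s : SymH 𝒱) :
    symRec n₀ hc (symι 𝒱 h * s) = β h s + γ h (symRec n₀ hc s) := by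
  have hfst := fst_apply_of_recStep adjoin_range_symι (symRep_symι hc) s (1, n₀)
  rw [mul_one] at hfst
  simp only [symRec, LinearMap.comp_apply, AlgHom.toLinearMap_apply,
    LinearMap.applyₗ_apply_apply, map_mul, Module.End.mul_apply, symRep_symι, recStep_apply,
    LinearMap.snd_apply, hfst]

end SymRec

section GradedDerivation

variable {V : Type*} [AddCommGroup V] [Module ℝ V] {𝒱 : ℤ → Submodule ℝ V} {d d' : ℤ}
  {D D' : ShuffleQuot 𝒱 →ₗ[ℝ] ShuffleQuot 𝒱} {F F' : SymH 𝒱 →ₗ[ℝ] SymH 𝒱}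

/-- `F` is the extension of the operator `D` on `𝓗[1]`, of degree `d`, to a graded derivation of
the symmetric algebra. -/
structure IsGradedDeriv (d : ℤ) (D : ShuffleQuot 𝒱 →ₗ[ℝ] ShuffleQuot 𝒱)
    (F : SymH 𝒱 →ₗ[ℝ] SymH 𝒱) : Prop where
  map_one : F 1 = 0
  map_wordClass_mul : ∀ x s, F (symι 𝒱 (wordClass x) * s) = symι 𝒱 (D (wordClass x)) * s +
    koszul d (wordDeg x) • (symι 𝒱 (wordClass x) * F s)

theorem IsGradedDeriv.map_symι_mul (hF : IsGradedDeriv d D F) {e : ℤ} {h : ShuffleQuot 𝒱}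
    (hh : h ∈ degClass 𝒱 e) (s : SymH 𝒱) :
    F (symι 𝒱 h * s) = symι 𝒱 (D h) * s + koszul d e • (symι 𝒱 h * F s) :=
  eq_of_mem_degClass (F ∘ₗ LinearMap.mulRight ℝ s ∘ₗ symι 𝒱)
    (LinearMap.mulRight ℝ s ∘ₗ symι 𝒱 ∘ₗ D +
      koszul d e • (LinearMap.mulRight ℝ (F s) ∘ₗ symι 𝒱))
    (fun w hw => by simp [hF.map_wordClass_mul, hw]) hh

theorem IsGradedDeriv.ext (hV : DirectSum.IsInternal 𝒱) (hF : IsGradedDeriv d D F)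
    (hF' : IsGradedDeriv d D F') : F = F' :=
  symH_linearMap_ext_of_mul hV (hF.map_one.trans hF'.map_one.symm) fun x s hs => by
    rw [hF.map_wordClass_mul, hF'.map_wordClass_mul, hs]

theorem IsGradedDeriv.smul (c : ℝ) (hF : IsGradedDeriv d D F) :
    IsGradedDeriv d (c • D) (c • F) where
  map_one := by simp [hF.map_one]
  map_wordClass_mul x s := by
    simp only [LinearMap.smul_apply, hF.map_wordClass_mul, map_smul, smul_add, smul_mul_assoc,
      mul_smul_comm, smul_comm c]

theorem IsGradedDeriv.commutator (hF : IsGradedDeriv d D F) (hF' : IsGradedDeriv d' D' F')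
    (hD : ∀ x, D (wordClass x) ∈ degClass 𝒱 (wordDeg x + d))
    (hD' : ∀ x, D' (wordClass x) ∈ degClass 𝒱 (wordDeg x + d')) :
    IsGradedDeriv (d + d') (D ∘ₗ D' - koszul d d' • D' ∘ₗ D)
      (F ∘ₗ F' - koszul d d' • F' ∘ₗ F) where
  map_one := by simp [hF.map_one, hF'.map_one]
  map_wordClass_mul x s := by
    simp only [LinearMap.sub_apply, LinearMap.smul_apply, LinearMap.comp_apply, map_sub, map_add,
      map_smul, hF.map_wordClass_mul, hF'.map_wordClass_mul, hF.map_symι_mul (hD' x),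
      hF'.map_symι_mul (hD x), sub_mul, mul_sub, smul_mul_assoc, mul_smul_comm, smul_add,
      smul_sub, smul_smul, koszul_add_left, koszul_add_right]
    match_scalars <;> grind

theorem exists_isGradedDeriv (hV : DirectSum.IsInternal 𝒱)
    (hD : ∀ x, D (wordClass x) ∈ degClass 𝒱 (wordDeg x + d)) : ∃ F, IsGradedDeriv d D F := by
  have hc : SymCompatible (LinearMap.mul ℝ (SymH 𝒱) ∘ₗ symι 𝒱 ∘ₗ D)
      (LinearMap.mul ℝ (SymH 𝒱) ∘ₗ symι 𝒱 ∘ₗ twistClass hV d) := by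
    intro x y s n
    have hx := wordClass_mem_degClass x
    have hy := wordClass_mem_degClass y
    simp only [LinearMap.comp_apply, LinearMap.mul_apply', LinearMap.smul_apply,
      twistClass_wordClass, map_smul, mul_add, mul_smul_comm]
    rw [symι_left_comm (hD x) hy, symι_left_comm (hD y) hx, symι_left_comm hx hy]
    simp only [smul_add, smul_smul, koszul_add_left]
    match_scalars <;> grind
  exact ⟨symRec 0 hc, symRec_one 0 hc, fun x s => by
    simp [symRec_symι_mul 0 hc, twistClass_wordClass]⟩

end GradedDerivation

namespace GerstenhaberAlgebra

variable {G : Type*} [AddCommGroup G] [Module ℝ G] (A : GerstenhaberAlgebra G)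

theorem exists_mulSym : ∃ F, IsGradedDeriv 1 A.mulClass F :=
  exists_isGradedDeriv A.isInternal fun x => A.mulClass_mem_degClass (wordClass_mem_degClass x)

/-- The operator `m` on the symmetric algebra. -/
def mulSym : SymH A.grade →ₗ[ℝ] SymH A.grade := A.exists_mulSym.choose

theorem isGradedDeriv_mulSym : IsGradedDeriv 1 A.mulClass A.mulSym := A.exists_mulSym.choose_spec

theorem lieClass_wordClass_mem_degClass {e : ℤ} {h : ShuffleQuot A.grade}
    (hh : h ∈ degClass A.grade e) (y : List (Letter A.grade)) :
    A.lieClass h (wordClass y) ∈ degClass A.grade (wordDeg y + (e + 1)) := by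
  rw [show wordDeg y + (e + 1) = e + wordDeg y + 1 by ring]
  exact A.lieClass_mem_degClass hh (wordClass_mem_degClass y)

theorem exists_adSym : ∃ B : ShuffleQuot A.grade →ₗ[ℝ] SymH A.grade →ₗ[ℝ] SymH A.grade,
    ∀ x, IsGradedDeriv (wordDeg x + 1) (A.lieClass (wordClass x)) (B (wordClass x)) := by
  choose F hF using fun x : List (Letter A.grade) => exists_isGradedDeriv A.isInternal
    (A.lieClass_wordClass_mem_degClass (wordClass_mem_degClass x))
  obtain ⟨B, hB⟩ := exists_bilinear_of_span (span_range_wordClass A.isInternal)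
    (span_range_symProd A.isInternal) (fun x Y => F x (symProd Y)) (fun x => ⟨F x, fun _ => rfl⟩)
    fun Y => by
      induction Y with
      | nil => exact ⟨0, fun x => (hF x).map_one.symm⟩
      | cons y Y ih =>
        obtain ⟨φ, hφ⟩ := ih
        refine ⟨LinearMap.mulRight ℝ (symProd Y) ∘ₗ symι A.grade ∘ₗ A.lieClass.flip (wordClass y) +
          LinearMap.mulLeft ℝ (koszul 1 (wordDeg y) • symι A.grade (wordClass y)) ∘ₗ φ ∘ₗ
            twistClass A.isInternal (wordDeg y), fun x => ?_⟩
        simp [(hF x).map_wordClass_mul, twistClass_wordClass, hφ, smul_smul, koszul_add_left,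
          koszul_comm (wordDeg y)]
  refine ⟨B, fun x => ?_⟩
  rw [symH_linearMap_ext A.isInternal (hB x)]
  exact hF x

/-- The operators `ℓ(h, ·)` on `𝓗[1]`, extended to the symmetric algebra as derivations. -/
def adSym : ShuffleQuot A.grade →ₗ[ℝ] SymH A.grade →ₗ[ℝ] SymH A.grade := A.exists_adSym.choose

theorem isGradedDeriv_adSym {e : ℤ} {h : ShuffleQuot A.grade} (hh : h ∈ degClass A.grade e) :
    IsGradedDeriv (e + 1) (A.lieClass h) (A.adSym h) where
  map_one := eq_of_mem_degClass (A.adSym.flip 1) 0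
    (fun x _ => (A.exists_adSym.choose_spec x).map_one) hh
  map_wordClass_mul y s := eq_of_mem_degClass (A.adSym.flip (symι A.grade (wordClass y) * s))
    (LinearMap.mulRight ℝ s ∘ₗ symι A.grade ∘ₗ A.lieClass.flip (wordClass y) +
      koszul (e + 1) (wordDeg y) •
        (LinearMap.mulLeft ℝ (symι A.grade (wordClass y)) ∘ₗ A.adSym.flip s))
    (fun x hx => by subst hx; exact (A.exists_adSym.choose_spec x).map_wordClass_mul y s) hh

theorem lieSym_compatible : SymCompatible A.adSym
    (LinearMap.mul ℝ (SymH A.grade) ∘ₗ symι A.grade ∘ₗ twistClass A.isInternal 1) := by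
  intro x y s n
  have hx := wordClass_mem_degClass x
  have hy := wordClass_mem_degClass y
  simp only [LinearMap.comp_apply, LinearMap.mul_apply', LinearMap.smul_apply,
    twistClass_wordClass, map_smul, mul_add, mul_smul_comm]
  rw [(A.isGradedDeriv_adSym hx).map_wordClass_mul, (A.isGradedDeriv_adSym hy).map_wordClass_mul,
    A.lieClass_comm hx hy, symι_left_comm hx hy]
  simp only [smul_mul_assoc, map_smul, smul_add, smul_smul, koszul_add_left]
  match_scalars <;> grind

/-- The operator `ℓ` on the symmetric algebra. -/
def lieSym : SymH A.grade →ₗ[ℝ] SymH A.grade := symRec 0 A.lieSym_compatible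

@[simp] theorem lieSym_one : A.lieSym 1 = 0 := symRec_one _ _

theorem lieSym_symι_mul {e : ℤ} {h : ShuffleQuot A.grade} (hh : h ∈ degClass A.grade e)
    (s : SymH A.grade) : A.lieSym (symι A.grade h * s) =
      A.adSym h s + koszul 1 e • (symι A.grade h * A.lieSym s) := by
  rw [lieSym, symRec_symι_mul]
  simp [twistClass_of_mem_degClass A.isInternal 1 hh]

theorem mulSym_mulSym (s : SymH A.grade) : A.mulSym (A.mulSym s) = 0 := by
  have hm := A.isGradedDeriv_mulSym
  have hdeg (x) := A.mulClass_mem_degClass (wordClass_mem_degClass x)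
  have hsq := hm.commutator hm hdeg hdeg
  have hzero : A.mulClass ∘ₗ A.mulClass = 0 := LinearMap.ext A.mulClass_mulClass
  rw [hzero, smul_zero, sub_zero] at hsq
  have hF := LinearMap.congr_fun (hsq.ext A.isInternal (F' := 0) ⟨by simp, by simp⟩) s
  simpa [← two_smul ℝ] using hF

theorem mulSym_adSym (x : List (Letter A.grade)) (s : SymH A.grade) :
    A.mulSym (A.adSym (wordClass x) s) = -A.adSym (A.mulClass (wordClass x)) s -
      koszul 1 (wordDeg x) • A.adSym (wordClass x) (A.mulSym s) := by
  have hx := wordClass_mem_degClass x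
  have hmx := A.mulClass_mem_degClass hx
  have hcomm := A.isGradedDeriv_mulSym.commutator (A.isGradedDeriv_adSym hx)
    (fun y => A.mulClass_mem_degClass (wordClass_mem_degClass y))
    (A.lieClass_wordClass_mem_degClass hx)
  have hderiv : A.mulClass ∘ₗ A.lieClass (wordClass x) -
      koszul 1 (wordDeg x + 1) • A.lieClass (wordClass x) ∘ₗ A.mulClass =
        (-1 : ℝ) • A.lieClass (A.mulClass (wordClass x)) := by
    refine LinearMap.ext_on_range (span_range_wordClass A.isInternal) fun y => ?_
    have hmul := A.mulClass_lieClass x y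
    simp only [LinearMap.sub_apply, LinearMap.smul_apply, LinearMap.comp_apply, koszul_add_right,
      koszul_one_one]
    linear_combination (norm := module) (1 : ℝ) • hmul
  rw [hderiv, add_comm 1] at hcomm
  have hF := LinearMap.congr_fun
    (hcomm.ext A.isInternal ((A.isGradedDeriv_adSym hmx).smul (-1))) s
  simp only [LinearMap.sub_apply, LinearMap.smul_apply, LinearMap.comp_apply, koszul_add_right,
    koszul_one_one] at hF
  linear_combination (norm := module) (1 : ℝ) • hF

theorem adSym_lieClass (x y : List (Letter A.grade)) (s : SymH A.grade) :
    A.adSym (A.lieClass (wordClass x) (wordClass y)) s =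
      -koszul 1 (wordDeg x) • A.adSym (wordClass x) (A.adSym (wordClass y) s) -
        koszul (wordDeg x + 1) (wordDeg y) • A.adSym (wordClass y) (A.adSym (wordClass x) s) := by
  have hx := wordClass_mem_degClass x
  have hy := wordClass_mem_degClass y
  have hcomm := ((A.isGradedDeriv_adSym hx).commutator (A.isGradedDeriv_adSym hy)
    (A.lieClass_wordClass_mem_degClass hx) (A.lieClass_wordClass_mem_degClass hy)).smul
      (-koszul 1 (wordDeg x))
  have hjacobi : -koszul 1 (wordDeg x) • (A.lieClass (wordClass x) ∘ₗ A.lieClass (wordClass y) -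
      koszul (wordDeg x + 1) (wordDeg y + 1) •
        A.lieClass (wordClass y) ∘ₗ A.lieClass (wordClass x)) =
        A.lieClass (A.lieClass (wordClass x) (wordClass y)) := by
    refine LinearMap.ext_on_range (span_range_wordClass A.isInternal) fun z => ?_
    have hjac := A.lieClass_jacobi x y z
    linear_combination (norm := skip) (-1 : ℝ) • hjac
    simp only [LinearMap.sub_apply, LinearMap.smul_apply, LinearMap.comp_apply, koszul_add_left,
      koszul_add_right, koszul_one_one, smul_sub, smul_smul]
    match_scalars <;> grind
  rw [hjacobi, show wordDeg x + 1 + (wordDeg y + 1) = wordDeg x + wordDeg y + 1 + 1 by ring]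
    at hcomm
  have hF := LinearMap.congr_fun
    ((A.isGradedDeriv_adSym (A.lieClass_mem_degClass hx hy)).ext A.isInternal hcomm) s
  simp only [LinearMap.sub_apply, LinearMap.smul_apply, LinearMap.comp_apply] at hF
  rw [hF]
  simp only [smul_sub, smul_smul, koszul_add_left, koszul_add_right, koszul_one_one]
  match_scalars <;> grind

theorem mulSym_lieSym_add_lieSym_mulSym (s : SymH A.grade) :
    A.mulSym (A.lieSym s) + A.lieSym (A.mulSym s) = 0 := by
  have hm := A.isGradedDeriv_mulSym
  refine LinearMap.congr_fun (f := A.mulSym ∘ₗ A.lieSym + A.lieSym ∘ₗ A.mulSym) (g := 0)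
    (symH_linearMap_ext_of_mul A.isInternal (by simp [hm.map_one]) fun x s hs => ?_) s
  have hx := wordClass_mem_degClass x
  have hmul := congrArg (symι A.grade (wordClass x) * ·) hs
  simp only [LinearMap.add_apply, LinearMap.comp_apply, LinearMap.zero_apply, mul_add,
    mul_zero] at hmul ⊢
  rw [A.lieSym_symι_mul hx, map_add, map_smul, hm.map_wordClass_mul, hm.map_wordClass_mul, map_add,
    map_smul, A.lieSym_symι_mul hx, A.lieSym_symι_mul (A.mulClass_mem_degClass hx), mulSym_adSym]
  linear_combination (norm := skip) (1 : ℝ) • hmul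
  simp only [smul_add, smul_smul, koszul_add_right, koszul_one_one]
  match_scalars <;> grind

theorem lieSym_adSym (x : List (Letter A.grade)) (s : SymH A.grade) :
    A.lieSym (A.adSym (wordClass x) s) =
      -koszul 1 (wordDeg x) • A.adSym (wordClass x) (A.lieSym s) := by
  have hx := wordClass_mem_degClass x
  have had := A.isGradedDeriv_adSym hx
  refine LinearMap.congr_fun (f := A.lieSym ∘ₗ A.adSym (wordClass x))
    (g := -koszul 1 (wordDeg x) • (A.adSym (wordClass x) ∘ₗ A.lieSym))
    (symH_linearMap_ext_of_mul A.isInternal (by simp [had.map_one]) fun y s hs => ?_) s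
  have hy := wordClass_mem_degClass y
  simp only [LinearMap.comp_apply, LinearMap.smul_apply] at hs ⊢
  rw [had.map_wordClass_mul, map_add, map_smul, A.lieSym_symι_mul (A.lieClass_mem_degClass hx hy),
    A.lieSym_symι_mul hy, A.lieSym_symι_mul hy, map_add, map_smul, had.map_wordClass_mul, hs,
    adSym_lieClass]
  simp only [mul_smul_comm, smul_add, smul_smul, koszul_add_left, koszul_add_right,
    koszul_one_one]
  match_scalars <;> grind

theorem lieSym_lieSym (s : SymH A.grade) : A.lieSym (A.lieSym s) = 0 := by
  refine LinearMap.congr_fun (f := A.lieSym ∘ₗ A.lieSym) (g := 0)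
    (symH_linearMap_ext_of_mul A.isInternal (by simp) fun x s hs => ?_) s
  have hx := wordClass_mem_degClass x
  simp only [LinearMap.comp_apply, LinearMap.zero_apply] at hs ⊢
  rw [A.lieSym_symι_mul hx, map_add, map_smul, A.lieSym_symι_mul hx, hs, lieSym_adSym, mul_zero,
    smul_zero, add_zero, ← add_smul, neg_add_cancel, zero_smul]

theorem boundary_comp_boundary :
    (A.mulSym + A.lieSym) ∘ₗ (A.mulSym + A.lieSym) = 0 := by
  ext1 s
  simp only [LinearMap.comp_apply, LinearMap.add_apply, map_add, mulSym_mulSym, lieSym_lieSym,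
    LinearMap.zero_apply, zero_add, add_zero]
  rw [_root_.add_comm]
  exact A.mulSym_lieSym_add_lieSym_mulSym s

end GerstenhaberAlgebra

section GradedDerivation

variable {V : Type*} [AddCommGroup V] [Module ℝ V] {𝒱 : ℤ → Submodule ℝ V}

theorem symι_mul_symProd {e : ℤ} {h : ShuffleQuot 𝒱} (hh : h ∈ degClass 𝒱 e)
    (X : List (List (Letter 𝒱))) : symι 𝒱 h * symProd X =
      koszul e (X.map wordDeg).sum • (symProd X * symι 𝒱 h) := by
  induction X with
  | nil => simp
  | cons x X ih =>
    rw [symProd_cons, symι_left_comm hh (wordClass_mem_degClass x), ih, mul_smul_comm, smul_smul,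
      mul_assoc, List.map_cons, List.sum_cons, koszul_add_right]

theorem symProd_take_mul_symProd_drop (X : List (List (Letter 𝒱))) (j : ℕ) :
    symProd (X.take j) * symProd (X.drop (j + 1)) = symProd (X.eraseIdx j) := by
  rw [List.eraseIdx_eq_take_drop_succ, symProd_append]

variable {d : ℤ} {D : ShuffleQuot 𝒱 →ₗ[ℝ] ShuffleQuot 𝒱} {F : SymH 𝒱 →ₗ[ℝ] SymH 𝒱}

theorem IsGradedDeriv.map_symι_wordClass (hF : IsGradedDeriv d D F) (x : List (Letter 𝒱)) :
    F (symι 𝒱 (wordClass x)) = symι 𝒱 (D (wordClass x)) := by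
  simpa [hF.map_one] using hF.map_wordClass_mul x 1

theorem IsGradedDeriv.map_symProd_mul (hF : IsGradedDeriv d D F) (X : List (List (Letter 𝒱)))
    (s : SymH 𝒱) : F (symProd X * s) =
      F (symProd X) * s + koszul d (X.map wordDeg).sum • (symProd X * F s) := by
  induction X with
  | nil => simp [hF.map_one]
  | cons x X ih =>
    simp only [symProd_cons, mul_assoc, hF.map_wordClass_mul, ih, mul_add, add_mul, smul_add,
      smul_mul_assoc, mul_smul_comm, smul_smul, List.map_cons, List.sum_cons, koszul_add_right,
      add_assoc]

theorem IsGradedDeriv.map_symProd (hF : IsGradedDeriv d D F) (X : List (List (Letter 𝒱))) :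
    F (symProd X) = ∑ j : Fin X.length, koszul d ((X.take j).map wordDeg).sum •
      (symProd (X.take j) * symι 𝒱 (D (wordClass (X.get j))) * symProd (X.drop (j + 1))) := by
  induction X with
  | nil => simp [hF.map_one]
  | cons x X ih =>
    rw [symProd_cons, hF.map_wordClass_mul, ih]
    refine Eq.trans ?_ (Fin.sum_univ_succ (n := X.length) _).symm
    simp [Finset.mul_sum, Finset.smul_sum, smul_smul, koszul_add_right, mul_assoc]

end GradedDerivation

namespace GerstenhaberAlgebra

variable {G : Type*} [AddCommGroup G] [Module ℝ G] (A : GerstenhaberAlgebra G)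

theorem mBlock_eq_symι_mulClass (x : List (Letter A.grade)) :
    A.mBlock x = symι A.grade (A.mulClass (wordClass x)) := by
  rw [mBlock, mulTens_eq_mulMap, proj_eq_symι_mkQ, ← mkQ_tens, mulClass_mkQ]

theorem lBlock_eq_symι_lieClass (x y : List (Letter A.grade)) :
    A.lBlock x y = symι A.grade (A.lieClass (wordClass x) (wordClass y)) := by
  rw [lBlock, bracketTens_eq_bracketMap, proj_eq_symι_mkQ, lieClass_wordClass, map_smul,
    ← mkQ_tens y, bracketClass_mkQ, koszul_one_left]

theorem isProductExtension_mulSym : A.IsProductExtension A.mulSym := fun X => by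
  simp only [A.isGradedDeriv_mulSym.map_symProd, koszul_one_left, mBlock_eq_symι_mulClass]

theorem adSym_symProd (x : List (Letter A.grade)) (Z : List (List (Letter A.grade))) :
    A.adSym (wordClass x) (symProd Z) = ∑ j : Fin Z.length,
      koszul (wordDeg (Z.get j)) ((Z.take j).map wordDeg).sum •
        (A.lBlock x (Z.get j) * symProd (Z.eraseIdx j)) := by
  have hx := wordClass_mem_degClass x
  rw [(A.isGradedDeriv_adSym hx).map_symProd]
  refine Finset.sum_congr rfl fun j _ => ?_
  rw [lBlock_eq_symι_lieClass, ← symProd_take_mul_symProd_drop, ← _root_.mul_assoc,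
    symι_mul_symProd (A.lieClass_mem_degClass hx (wordClass_mem_degClass (Z.get j))),
    smul_mul_assoc, smul_smul]
  simp only [koszul_add_left]
  congr 1
  grind

theorem lieSym_symProd (X : List (List (Letter A.grade))) :
    A.lieSym (symProd X) = ∑ i : Fin X.length, ∑ j : Fin X.length,
      if i < j then
        (koszul (wordDeg (X.get i)) ((X.take i).map wordDeg).sum *
            koszul (wordDeg (X.get j)) (((X.take j).eraseIdx i).map wordDeg).sum) •
          (A.lBlock (X.get i) (X.get j) * symProd ((X.eraseIdx j).eraseIdx i))
      else 0 := by
  induction X with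
  | nil => simp
  | cons x X ih =>
    have hx := wordClass_mem_degClass x
    rw [symProd_cons, A.lieSym_symι_mul hx, ih, adSym_symProd]
    refine Eq.trans ?_ (Fin.sum_univ_succ (n := X.length) _).symm
    congr 1
    · refine Eq.trans ?_ (Fin.sum_univ_succ (n := X.length) _).symm
      simp
    · rw [Finset.mul_sum, Finset.smul_sum]
      refine Finset.sum_congr rfl fun i _ => ?_
      refine Eq.trans ?_ (Fin.sum_univ_succ (n := X.length) _).symm
      rw [if_neg (by simp), zero_add, Finset.mul_sum, Finset.smul_sum]
      refine Finset.sum_congr rfl fun j _ => ?_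
      simp only [Fin.succ_lt_succ_iff]
      split_ifs
      · simp only [List.get_eq_getElem, Fin.val_succ, List.getElem_cons_succ, List.take_succ_cons,
          List.map_cons, List.sum_cons, List.eraseIdx_cons_succ, symProd_cons, mul_smul_comm,
          lBlock_eq_symι_lieClass]
        rw [symι_left_comm hx (A.lieClass_mem_degClass (wordClass_mem_degClass _)
          (wordClass_mem_degClass _)), smul_smul, smul_smul]
        simp only [koszul_add_right]
        congr 1
        grind
      · simp

theorem isBracketExtension_lieSym : A.IsBracketExtension A.lieSym := fun X => by
  simp only [lieSym_symProd, koszul, ← zpow_add₀ (show (-1 : ℝ) ≠ 0 by norm_num)]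

variable {A} in
theorem IsProductExtension.unique {m m' : SymH A.grade →ₗ[ℝ] SymH A.grade}
    (h : A.IsProductExtension m) (h' : A.IsProductExtension m') : m = m' :=
  symH_linearMap_ext A.isInternal fun X => by rw [h X, h' X]

variable {A} in
theorem IsBracketExtension.unique {l l' : SymH A.grade →ₗ[ℝ] SymH A.grade}
    (h : A.IsBracketExtension l) (h' : A.IsBracketExtension l') : l = l' :=
  symH_linearMap_ext A.isInternal fun X => by rw [h X, h' X]

theorem mulSym_symProd_mul_symι (X : List (List (Letter A.grade))) (y : List (Letter A.grade)) :
    A.mulSym (symProd X * symι A.grade (wordClass y)) =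
      A.mulSym (symProd X) * symι A.grade (wordClass y) +
        (-1 : ℝ) ^ (X.map wordDeg).sum • (symProd X * A.mBlock y) := by
  have hm := A.isGradedDeriv_mulSym
  rw [hm.map_symProd_mul, hm.map_symι_wordClass, koszul_one_left, mBlock_eq_symι_mulClass]

theorem lieSym_symι_wordClass (y : List (Letter A.grade)) :
    A.lieSym (symι A.grade (wordClass y)) = 0 := by
  simpa using A.lieSym_symProd [y]

theorem lieSym_symProd_mul_symι (X : List (List (Letter A.grade))) (y : List (Letter A.grade)) :
    A.lieSym (symProd X * symι A.grade (wordClass y)) =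
      A.lieSym (symProd X) * symι A.grade (wordClass y) +
        ∑ i : Fin X.length, (koszul 1 ((X.eraseIdx i).map wordDeg).sum *
            koszul (wordDeg (X.get i)) ((X.drop (i + 1)).map wordDeg).sum) •
          (symProd (X.eraseIdx i) * A.lBlock (X.get i) y) := by
  induction X with
  | nil => simp [lieSym_symι_wordClass]
  | cons x X ih =>
    have hx := wordClass_mem_degClass x
    have had := A.isGradedDeriv_adSym hx
    rw [symProd_cons, _root_.mul_assoc, A.lieSym_symι_mul hx, ih, A.lieSym_symι_mul hx,
      had.map_symProd_mul, had.map_symι_wordClass, ← lBlock_eq_symι_lieClass]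
    refine Eq.trans ?_ (congrArg _ (Fin.sum_univ_succ (n := X.length) _).symm)
    simp only [List.get_eq_getElem, Fin.val_zero, List.getElem_cons_zero, List.drop_succ_cons,
      List.drop_zero, List.eraseIdx_cons_zero, Fin.val_succ, List.getElem_cons_succ,
      List.eraseIdx_cons_succ, List.map_cons, List.sum_cons, symProd_cons, mul_add, add_mul,
      smul_add, Finset.mul_sum, Finset.smul_sum, mul_smul_comm, smul_mul_assoc, smul_smul,
      _root_.mul_assoc, koszul_add_left, koszul_add_right]
    rw [_root_.mul_comm (koszul (wordDeg x) _)]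
    abel

theorem lieSym_symProd_map_mul_symι {α : Type*} (f : α → List (Letter A.grade)) (X : List α)
    (y : List (Letter A.grade)) :
    A.lieSym (symProd (X.map f) * symι A.grade (wordClass y)) =
      A.lieSym (symProd (X.map f)) * symι A.grade (wordClass y) +
        ∑ i : Fin X.length, ((-1 : ℝ) ^ (((X.eraseIdx i).map f).map wordDeg).sum *
            (-1 : ℝ) ^ (wordDeg (f (X.get i)) * (((X.drop (i + 1)).map f).map wordDeg).sum)) •
          (symProd ((X.eraseIdx i).map f) * A.lBlock (f (X.get i)) y) := by
  rw [lieSym_symProd_mul_symι, ← Equiv.sum_comp (finCongr (List.length_map f).symm)]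
  simp [List.eraseIdx_map, koszul]

end GerstenhaberAlgebra

section Homogeneous

variable {V D : Type*} [AddCommGroup V] [Module ℝ V] {𝒱 : ℤ → Submodule ℝ V} [AddCommMonoid D]

/-- The lists of words whose letters have degrees, in the sense of the relation `r`, of given
sum. -/
inductive ProdHasDeg (r : Letter 𝒱 → D → Prop) : List (List (Letter 𝒱)) → D → Prop
  | nil : ProdHasDeg r [] 0
  | cons {x : List (Letter 𝒱)} {X : List (List (Letter 𝒱))} {δ ε : D} :
      WordHasDeg r x δ → ProdHasDeg r X ε → ProdHasDeg r (x :: X) (δ + ε)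

/-- The homogeneous part of degree `δ`, in the sense of the relation `r`, of the positive part of
the symmetric algebra. -/
def homSym (r : Letter 𝒱 → D → Prop) (δ : D) : Submodule ℝ (SymH 𝒱) :=
  Submodule.span ℝ {z | ∃ X, X ≠ [] ∧ ProdHasDeg r X δ ∧ z = symProd X}

variable {r : Letter 𝒱 → D → Prop} {δ ε : D}

theorem symProd_mem_homSym {X : List (List (Letter 𝒱))} (hX : X ≠ []) (h : ProdHasDeg r X δ) :
    symProd X ∈ homSym r δ := Submodule.subset_span ⟨X, hX, h, rfl⟩

theorem wordClass_mem_homClass {w : List (Letter 𝒱)} (h : WordHasDeg r w δ) :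
    wordClass w ∈ homClass r δ := Submodule.mem_map_of_mem (tens_mem_homTens h)

theorem symι_mul_symProd_mem_homSym {h : ShuffleQuot 𝒱} (hh : h ∈ homClass r δ)
    {X : List (List (Letter 𝒱))} (hX : ProdHasDeg r X ε) :
    symι 𝒱 h * symProd X ∈ homSym r (δ + ε) :=
  map_mem_of_mem_homClass (LinearMap.mulRight ℝ (symProd X) ∘ₗ symι 𝒱)
    (fun w hw => symProd_mem_homSym (X := w :: X) (by simp) (.cons hw hX)) hh

theorem symι_mul_mem_homSym {h : ShuffleQuot 𝒱} (hh : h ∈ homClass r δ) {s : SymH 𝒱}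
    (hs : s ∈ homSym r ε) : symι 𝒱 h * s ∈ homSym r (δ + ε) := by
  have hle : homSym r ε ≤ (homSym r (δ + ε)).comap (LinearMap.mulLeft ℝ (symι 𝒱 h)) := by
    refine Submodule.span_le.2 ?_
    rintro _ ⟨X, -, hX, rfl⟩
    exact symι_mul_symProd_mem_homSym hh hX
  exact hle hs

theorem WordHasDeg.append {x y : List (Letter 𝒱)} (hx : WordHasDeg r x δ)
    (hy : WordHasDeg r y ε) : WordHasDeg r (x ++ y) (δ + ε) := by
  induction hx with
  | nil => simpa
  | cons ha _ ih => rw [add_assoc]; exact .cons ha ih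

theorem ProdHasDeg.append {X Y : List (List (Letter 𝒱))} (hX : ProdHasDeg r X δ)
    (hY : ProdHasDeg r Y ε) : ProdHasDeg r (X ++ Y) (δ + ε) := by
  induction hX with
  | nil => simpa
  | cons hx _ ih => rw [add_assoc]; exact .cons hx ih

theorem IsGradedDeriv.map_symProd_mem_homSym {d : ℤ} {D₀ : ShuffleQuot 𝒱 →ₗ[ℝ] ShuffleQuot 𝒱}
    {F : SymH 𝒱 →ₗ[ℝ] SymH 𝒱} (hF : IsGradedDeriv d D₀ F) {μ : D}
    (hD : ∀ {w : List (Letter 𝒱)} {δ : D}, WordHasDeg r w δ →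
      D₀ (wordClass w) ∈ homClass r (δ + μ))
    {X : List (List (Letter 𝒱))} (hX : ProdHasDeg r X δ) : F (symProd X) ∈ homSym r (δ + μ) := by
  induction hX with
  | nil => simp [hF.map_one]
  | @cons x X δ ε hx hX ih =>
    rw [symProd_cons, hF.map_wordClass_mul]
    refine add_mem ?_ (Submodule.smul_mem _ _ ?_)
    · rw [add_right_comm]
      exact symι_mul_symProd_mem_homSym (hD hx) hX
    · rw [add_assoc]
      exact symι_mul_mem_homSym (wordClass_mem_homClass hx) ih

end Homogeneous

namespace GerstenhaberAlgebra

variable {G D : Type*} [AddCommGroup G] [Module ℝ G] (A : GerstenhaberAlgebra G) [AddCommMonoid D]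
  {r : Letter A.grade → D → Prop} {δ ε μ : D}

theorem adSym_symProd_mem_homSym
    (hr : ∀ {a b : Letter A.grade} {δ ε : D}, r a δ → r b ε → r (A.bracketLetter a b) (δ + ε + μ))
    {x : List (Letter A.grade)} (hx : WordHasDeg r x δ)
    {X : List (List (Letter A.grade))} (hX : ProdHasDeg r X ε) :
    A.adSym (wordClass x) (symProd X) ∈ homSym r (δ + ε + μ) := by
  rw [add_comm δ, add_assoc]
  refine (A.isGradedDeriv_adSym (wordClass_mem_degClass x)).map_symProd_mem_homSym
    (fun {w δ'} hw => ?_) hX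
  rw [← add_assoc, add_comm δ']
  exact A.lieClass_mem_homClass hr (wordClass_mem_homClass hx) (wordClass_mem_homClass hw)

theorem lieSym_symProd_mem_homSym
    (hr : ∀ {a b : Letter A.grade} {δ ε : D}, r a δ → r b ε → r (A.bracketLetter a b) (δ + ε + μ))
    {X : List (List (Letter A.grade))} (hX : ProdHasDeg r X δ) :
    A.lieSym (symProd X) ∈ homSym r (δ + μ) := by
  induction hX with
  | nil => simp
  | @cons x X δ ε hx hX ih =>
    rw [symProd_cons, A.lieSym_symι_mul (wordClass_mem_degClass x)]
    refine add_mem (A.adSym_symProd_mem_homSym hr hx hX) (Submodule.smul_mem _ _ ?_)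
    rw [add_assoc]
    exact symι_mul_mem_homSym (wordClass_mem_homClass hx) ih

theorem boundary_mem_homSym
    (hmul : ∀ {a b : Letter A.grade} {δ ε : D}, r a δ → r b ε → r (A.mulLetter a b) (δ + ε + μ))
    (hbracket : ∀ {a b : Letter A.grade} {δ ε : D}, r a δ → r b ε →
      r (A.bracketLetter a b) (δ + ε + μ))
    {z : SymH A.grade} (hz : z ∈ homSym r δ) :
    (A.mulSym + A.lieSym) z ∈ homSym r (δ + μ) := by
  have hle : homSym r δ ≤ (homSym r (δ + μ)).comap (A.mulSym + A.lieSym) := by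
    refine Submodule.span_le.2 ?_
    rintro _ ⟨X, -, hX, rfl⟩
    exact add_mem (A.isGradedDeriv_mulSym.map_symProd_mem_homSym
      (fun hw => A.mulClass_mem_homClass hmul (wordClass_mem_homClass hw)) hX)
      (A.lieSym_symProd_mem_homSym hbracket hX)
  exact hle hz

end GerstenhaberAlgebra

section Length

variable {V : Type*} [AddCommGroup V] [Module ℝ V] {𝒱 : ℤ → Submodule ℝ V}

/-- Every letter has length `1`: the relation whose homogeneous parts are those of given total
number of letters. The length is an integer so that the boundary can lower it by `1`. -/
def HasLength (_ : Letter 𝒱) (n : ℤ) : Prop := n = 1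

theorem wordHasDeg_length (w : List (Letter 𝒱)) : WordHasDeg HasLength w (w.length : ℤ) := by
  induction w with
  | nil => exact .nil
  | cons a w ih => rw [List.length_cons, Nat.cast_succ, add_comm]; exact .cons rfl ih

theorem prodHasDeg_length (X : List (List (Letter 𝒱))) :
    ProdHasDeg HasLength X ((X.map List.length).sum : ℕ) := by
  induction X with
  | nil => exact .nil
  | cons x X ih =>
    rw [List.map_cons, List.sum_cons, Nat.cast_add]; exact .cons (wordHasDeg_length x) ih

theorem WordHasDeg.length_eq {w : List (Letter 𝒱)} {n : ℤ} (h : WordHasDeg HasLength w n) :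
    (w.length : ℤ) = n := by
  induction h with
  | nil => rfl
  | cons ha _ ih => rw [List.length_cons, Nat.cast_succ, ih, ha, add_comm]

theorem ProdHasDeg.sum_length_eq {X : List (List (Letter 𝒱))} {n : ℤ}
    (h : ProdHasDeg HasLength X n) : ((X.map List.length).sum : ℤ) = n := by
  induction h with
  | nil => rfl
  | cons hx _ ih => rw [List.map_cons, List.sum_cons, Nat.cast_add, ih, hx.length_eq]

theorem symProd_eq_zero_of_nil_mem {X : List (List (Letter 𝒱))} (h : [] ∈ X) :
    symProd X = 0 := by
  induction X with
  | nil => simp at h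
  | cons x X ih =>
    rw [symProd_cons]
    rcases List.mem_cons.1 h with rfl | h
    · simp
    · rw [ih h, mul_zero]

end Length

namespace GerstenhaberAlgebra

variable {G : Type*} [AddCommGroup G] [Module ℝ G] (A : GerstenhaberAlgebra G)

theorem symProd_mem_chains {X : List (List (Letter A.grade))} (hX : X ≠ []) :
    symProd X ∈ A.chains (X.map List.length).sum := by
  by_cases hnil : [] ∈ X
  · rw [symProd_eq_zero_of_nil_mem hnil]
    exact zero_mem _
  · exact Submodule.subset_span ⟨X, hX, fun x hx hx' => hnil (hx' ▸ hx), rfl, rfl⟩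

theorem homSym_hasLength (N : ℕ) : homSym HasLength (N : ℤ) = A.chains N := by
  apply le_antisymm
  · refine Submodule.span_le.2 ?_
    rintro _ ⟨X, hX, hlen, rfl⟩
    obtain rfl : (X.map List.length).sum = N := by exact_mod_cast hlen.sum_length_eq
    exact A.symProd_mem_chains hX
  · refine Submodule.span_le.2 ?_
    rintro _ ⟨X, hX, -, rfl, rfl⟩
    exact symProd_mem_homSym hX (prodHasDeg_length X)

theorem boundary_mem_chains {N : ℕ} {z : SymH A.grade} (hz : z ∈ A.chains (N + 1)) :
    (A.mulSym + A.lieSym) z ∈ A.chains N := by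
  rw [← homSym_hasLength] at hz ⊢
  have hmem := A.boundary_mem_homSym (μ := -1) (by rintro _ _ _ _ rfl rfl; exact rfl)
    (by rintro _ _ _ _ rfl rfl; exact rfl) hz
  simpa using hmem

theorem chains_le_gInf (N : ℕ) : A.chains N ≤ A.gInf :=
  Submodule.span_mono fun _ ⟨X, hX, _, _, hz⟩ => ⟨X, hX, hz⟩

theorem boundary_mem_gInf {z : SymH A.grade} (hz : z ∈ A.gInf) :
    (A.mulSym + A.lieSym) z ∈ A.gInf := by
  have hle : A.gInf ≤ A.gInf.comap (A.mulSym + A.lieSym) := by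
    refine Submodule.span_le.2 ?_
    rintro _ ⟨X, hX, rfl⟩
    rcases hlen : (X.map List.length).sum with _ | N
    · obtain ⟨x, hx⟩ := List.exists_mem_of_ne_nil X hX
      have hnil : x = [] := by
        simpa using List.sum_eq_zero_iff.1 hlen _ (List.mem_map_of_mem hx)
      rw [symProd_eq_zero_of_nil_mem (hnil ▸ hx)]
      exact zero_mem _
    · exact A.chains_le_gInf N (A.boundary_mem_chains (hlen ▸ A.symProd_mem_chains hX))
  exact hle hz

end GerstenhaberAlgebra

namespace GerstenhaberModule

section Weight

variable {G M : Type*} [AddCommGroup G] [Module ℝ G] [AddCommGroup M] [Module ℝ M]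

/-- The elements of `G × M` of weight `k` for the grading with `G` in weight `0` and `M` in
weight `1`; only `0` has weight `k ≥ 2`. -/
def HasWeight (k : ℕ) (z : G × M) : Prop := (k ≠ 0 → z.1 = 0) ∧ (k ≠ 1 → z.2 = 0)

theorem HasWeight.bilin {k k' : ℕ} {z z' : G × M} (hz : HasWeight k z) (hz' : HasWeight k' z')
    (f : G →ₗ[ℝ] G →ₗ[ℝ] G) (g : G →ₗ[ℝ] M →ₗ[ℝ] M) (h : M →ₗ[ℝ] G →ₗ[ℝ] M) :
    HasWeight (k + k') (f z.1 z'.1, g z.1 z'.2 + h z.2 z'.1) := by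
  refine ⟨fun hk => ?_, fun hk => ?_⟩
  · obtain hk | hk : k ≠ 0 ∨ k' ≠ 0 := by omega
    · simp [hz.1 hk]
    · simp [hz'.1 hk]
  · obtain ⟨hk, hk'⟩ | ⟨hk, hk'⟩ | ⟨hk, hk'⟩ : k ≠ 0 ∧ k' ≠ 0 ∨ k ≠ 0 ∧ k ≠ 1 ∨ k ≠ 1 ∧ k' ≠ 1 := by
      omega
    · simp [hz.1 hk, hz'.1 hk']
    · simp [hz.1 hk, hz.2 hk']
    · simp [hz.2 hk, hz'.2 hk']

end Weight

variable {G M : Type*} [AddCommGroup G] [Module ℝ G] [AddCommGroup M] [Module ℝ M]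
  {A : GerstenhaberAlgebra G} (P : GerstenhaberModule A M)

/-- The degree of a letter of `G ⋉ M` whose sums over products of words are the pairs formed by the
number of letters and the number of letters from `M`. -/
def HasBidegree (a : Letter P.semidirect.grade) (δ : ℤ × ℕ) : Prop :=
  δ.1 = 1 ∧ HasWeight δ.2 (a.2 : G × M)

variable {P}

theorem HasBidegree.mulLetter {a b : Letter P.semidirect.grade} {δ ε : ℤ × ℕ}
    (ha : P.HasBidegree a δ) (hb : P.HasBidegree b ε) :
    P.HasBidegree (P.semidirect.mulLetter a b) (δ + ε + (-1, 0)) :=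
  ⟨by simp [ha.1, hb.1], ha.2.bilin hb.2 A.mul P.smul _⟩

theorem HasBidegree.bracketLetter {a b : Letter P.semidirect.grade} {δ ε : ℤ × ℕ}
    (ha : P.HasBidegree a δ) (hb : P.HasBidegree b ε) :
    P.HasBidegree (P.semidirect.bracketLetter a b) (δ + ε + (-1, 0)) := by
  refine ⟨by simp [ha.1, hb.1], ?_⟩
  have hweight := ha.2.bilin hb.2 A.bracket P.act (-gradedFlip A.isInternal P.isInternal 1 P.act)
  simp only [LinearMap.neg_apply, ← sub_eq_add_neg] at hweight
  exact hweight

theorem hasBidegree_inG (a : Letter A.grade) : P.HasBidegree (P.inG a) (1, 0) :=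
  ⟨rfl, fun h => (h rfl).elim, fun _ => rfl⟩

theorem hasBidegree_inM (v : Letter P.grade) : P.HasBidegree (P.inM v) (1, 1) :=
  ⟨rfl, fun _ => rfl, fun h => (h rfl).elim⟩

theorem HasBidegree.exists_eq_inG {a : Letter P.semidirect.grade} {n : ℤ}
    (h : P.HasBidegree a (n, 0)) : ∃ b, a = P.inG b := by
  obtain ⟨i, ⟨⟨b, v⟩, hb, hv⟩⟩ := a
  obtain rfl : v = 0 := h.2.2 (by simp)
  exact ⟨⟨i, b, hb⟩, rfl⟩

theorem HasBidegree.exists_eq_inM {a : Letter P.semidirect.grade} {n : ℤ}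
    (h : P.HasBidegree a (n, 1)) : ∃ v, a = P.inM v := by
  obtain ⟨i, ⟨⟨b, v⟩, hb, hv⟩⟩ := a
  obtain rfl : b = 0 := h.2.1 (by simp)
  exact ⟨⟨i, v, hv⟩, rfl⟩

theorem wordHasDeg_gWord (x : List (Letter A.grade)) :
    WordHasDeg P.HasBidegree (P.gWord x) ((x.length : ℤ), 0) := by
  induction x with
  | nil => exact .nil
  | cons a x ih => simpa [gWord, add_comm] using WordHasDeg.cons (P.hasBidegree_inG a) ih

theorem wordHasDeg_mWord (y : List (Letter A.grade)) (v : Letter P.grade)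
    (y' : List (Letter A.grade)) :
    WordHasDeg P.HasBidegree (P.mWord y v y') ((y.length : ℤ) + y'.length + 1, 1) := by
  have hword := (P.wordHasDeg_gWord y).append (.cons (P.hasBidegree_inM v) (P.wordHasDeg_gWord y'))
  simp only [Prod.mk_add_mk, add_zero, zero_add, add_comm (1 : ℤ), ← add_assoc] at hword
  exact hword

theorem prodHasDeg_map_gWord (X : List (List (Letter A.grade))) :
    ProdHasDeg P.HasBidegree (X.map P.gWord) (((X.map List.length).sum : ℤ), 0) := by
  induction X with
  | nil => exact .nil
  | cons x X ih => simpa using ProdHasDeg.cons (P.wordHasDeg_gWord x) ih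

theorem exists_eq_gWord {w : List (Letter P.semidirect.grade)} {δ : ℤ × ℕ}
    (h : WordHasDeg P.HasBidegree w δ) (hδ : δ.2 = 0) :
    ∃ x, w = P.gWord x ∧ (x.length : ℤ) = δ.1 := by
  induction h with
  | nil => exact ⟨[], rfl, rfl⟩
  | @cons a w δ ε ha _ ih =>
    obtain ⟨n, k⟩ := δ
    obtain rfl : n = 1 := ha.1
    obtain ⟨rfl, hε⟩ : k = 0 ∧ ε.2 = 0 := by simpa using hδ
    obtain ⟨b, rfl⟩ := ha.exists_eq_inG
    obtain ⟨x, rfl, hx⟩ := ih hε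
    exact ⟨b :: x, rfl, by simp [hx, add_comm]⟩

theorem exists_eq_mWord {w : List (Letter P.semidirect.grade)} {δ : ℤ × ℕ}
    (h : WordHasDeg P.HasBidegree w δ) (hδ : δ.2 = 1) :
    ∃ y v y', w = P.mWord y v y' ∧ (y.length : ℤ) + y'.length + 1 = δ.1 := by
  induction h with
  | nil => simp at hδ
  | @cons a w δ ε ha hw ih =>
    obtain ⟨n, k⟩ := δ
    obtain rfl : n = 1 := ha.1
    obtain ⟨rfl, hε⟩ | ⟨rfl, hε⟩ := Nat.add_eq_one_iff.1 hδ
    · obtain ⟨b, rfl⟩ := ha.exists_eq_inG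
      obtain ⟨y, v, y', rfl, hy⟩ := ih hε
      exact ⟨b :: y, v, y', rfl, by simp [← hy]; ring⟩
    · obtain ⟨v, rfl⟩ := ha.exists_eq_inM
      obtain ⟨x, rfl, hx⟩ := exists_eq_gWord hw hε
      exact ⟨[], v, x, rfl, by simp [← hx, add_comm]⟩

theorem exists_eq_map_gWord {X : List (List (Letter P.semidirect.grade))} {δ : ℤ × ℕ}
    (h : ProdHasDeg P.HasBidegree X δ) (hδ : δ.2 = 0) :
    ∃ X' : List (List (Letter A.grade)), X = X'.map P.gWord ∧
      ((X'.map List.length).sum : ℤ) = δ.1 := by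
  induction h with
  | nil => exact ⟨[], rfl, rfl⟩
  | @cons x X δ ε hx _ ih =>
    obtain ⟨hδ, hε⟩ := Nat.add_eq_zero_iff.1 hδ
    obtain ⟨x, rfl, hlen⟩ := exists_eq_gWord hx hδ
    obtain ⟨X, rfl, hsum⟩ := ih hε
    exact ⟨x :: X, rfl, by simp [← hlen, ← hsum]⟩

theorem symι_gWord_mul_mem_moduleChains (x : List (Letter A.grade)) {N : ℕ}
    {z : SymH P.semidirect.grade} (hz : z ∈ P.moduleChains N) :
    symι _ (wordClass (P.gWord x)) * z ∈ P.moduleChains (x.length + N) := by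
  rcases eq_or_ne x [] with rfl | hx
  · simp [gWord]
  have hle : P.moduleChains N ≤ (P.moduleChains (x.length + N)).comap
      (LinearMap.mulLeft ℝ (symι _ (wordClass (P.gWord x)))) := by
    refine Submodule.span_le.2 ?_
    rintro _ ⟨X, y, v, y', hX, rfl, rfl⟩
    refine Submodule.subset_span ⟨x :: X, y, v, y', by simpa [hx] using hX, by simp; ring, ?_⟩
    rw [List.map_cons, symProd_cons (P.gWord x), LinearMap.mulLeft_apply, mul_assoc]
  exact hle hz

theorem symProd_map_gWord_mul_mem_moduleChains (X : List (List (Letter A.grade)))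
    (y : List (Letter A.grade)) (v : Letter P.grade) (y' : List (Letter A.grade)) :
    symProd (X.map P.gWord) * symι _ (wordClass (P.mWord y v y')) ∈
      P.moduleChains ((X.map List.length).sum + (y.length + y'.length)) := by
  induction X with
  | nil => exact Submodule.subset_span ⟨[], y, v, y', by simp, by simp, by simp⟩
  | cons x X ih =>
    rw [List.map_cons, List.map_cons, symProd_cons (P.gWord x), mul_assoc, List.sum_cons,
      add_assoc]
    exact symι_gWord_mul_mem_moduleChains x ih

theorem exists_symProd_mem_moduleChains {X : List (List (Letter P.semidirect.grade))} {δ : ℤ × ℕ}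
    (h : ProdHasDeg P.HasBidegree X δ) (hδ : δ.2 = 1) :
    ∃ N : ℕ, δ.1 = N + 1 ∧ symProd X ∈ P.moduleChains N := by
  induction h with
  | nil => simp at hδ
  | @cons x X δ ε hx hX ih =>
    rw [symProd_cons]
    obtain ⟨hδ, hε⟩ | ⟨hδ, hε⟩ := Nat.add_eq_one_iff.1 hδ
    · obtain ⟨x, rfl, hlen⟩ := exists_eq_gWord hx hδ
      obtain ⟨N, hN, hX⟩ := ih hε
      refine ⟨x.length + N, ?_, symι_gWord_mul_mem_moduleChains x hX⟩
      simp [← hlen, hN, add_assoc]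
    · obtain ⟨y, v, y', rfl, hlen⟩ := exists_eq_mWord hx hδ
      obtain ⟨X, rfl, hsum⟩ := exists_eq_map_gWord hX hε
      refine ⟨(X.map List.length).sum + (y.length + y'.length), ?_, ?_⟩
      · simp only [Prod.fst_add, ← hlen, ← hsum]
        push_cast
        ring
      · rw [symι_mul_symProd (wordClass_mem_degClass _)]
        exact Submodule.smul_mem _ _ (symProd_map_gWord_mul_mem_moduleChains X y v y')

variable (P)

theorem homSym_hasBidegree_one (N : ℕ) :
    homSym P.HasBidegree ((N : ℤ) + 1, 1) = P.moduleChains N := by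
  apply le_antisymm
  · refine Submodule.span_le.2 ?_
    rintro _ ⟨X, -, hX, rfl⟩
    obtain ⟨N', hN, hmem⟩ := exists_symProd_mem_moduleChains hX rfl
    obtain rfl : N = N' := by simpa using hN
    exact hmem
  · refine Submodule.span_le.2 ?_
    rintro _ ⟨X, y, v, y', -, rfl, rfl⟩
    rw [← symProd_append]
    refine symProd_mem_homSym (by simp) ?_
    simpa [add_assoc] using
      (prodHasDeg_map_gWord X).append (.cons (P.wordHasDeg_mWord y v y') .nil)

theorem homSym_hasBidegree_zero_one : homSym P.HasBidegree (0, 1) = ⊥ := by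
  rw [eq_bot_iff]
  refine Submodule.span_le.2 ?_
  rintro _ ⟨X, -, hX, rfl⟩
  obtain ⟨N, hN, -⟩ := exists_symProd_mem_moduleChains hX rfl
  simp only at hN
  omega

theorem boundary_mem_homSym {n : ℤ} {k : ℕ} {z : SymH P.semidirect.grade}
    (hz : z ∈ homSym P.HasBidegree (n + 1, k)) :
    (P.semidirect.mulSym + P.semidirect.lieSym) z ∈ homSym P.HasBidegree (n, k) := by
  simpa using P.semidirect.boundary_mem_homSym HasBidegree.mulLetter HasBidegree.bracketLetter hz

theorem boundary_mem_moduleChains {N : ℕ} {z : SymH P.semidirect.grade}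
    (hz : z ∈ P.moduleChains (N + 1)) :
    (P.semidirect.mulSym + P.semidirect.lieSym) z ∈ P.moduleChains N := by
  rw [← homSym_hasBidegree_one] at hz ⊢
  exact P.boundary_mem_homSym (by exact_mod_cast hz)

theorem boundary_eq_zero_of_mem_moduleChains_zero {z : SymH P.semidirect.grade}
    (hz : z ∈ P.moduleChains 0) : (P.semidirect.mulSym + P.semidirect.lieSym) z = 0 := by
  rw [← homSym_hasBidegree_one] at hz
  simpa only [Nat.cast_zero, homSym_hasBidegree_zero_one, Submodule.mem_bot] using
    P.boundary_mem_homSym hz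

theorem moduleChains_le_chains (N : ℕ) : P.moduleChains N ≤ P.semidirect.chains (N + 1) := by
  refine Submodule.span_le.2 ?_
  rintro _ ⟨X, y, v, y', -, rfl, rfl⟩
  rw [← symProd_append]
  convert P.semidirect.symProd_mem_chains (X := X.map P.gWord ++ [P.mWord y v y']) (by simp) using 2
  have hlen : List.length ∘ P.gWord = List.length := funext fun x => by simp [gWord]
  simp [hlen, mWord, gWord, add_assoc]

end GerstenhaberModule

end

theorem mainTheorem6 {G M : Type*} [AddCommGroup G] [Module ℝ G] [AddCommGroup M] [Module ℝ M]
    (A : GerstenhaberAlgebra G) (P : GerstenhaberModule A M) :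
    ∃ m l : SymH P.semidirect.grade →ₗ[ℝ] SymH P.semidirect.grade,
      -- `m` and `l` are the two well-defined operators of `G_∞(G ⋉ M)`
      (P.semidirect.IsProductExtension m ∧
        ∀ m', P.semidirect.IsProductExtension m' → m' = m) ∧
      (P.semidirect.IsBracketExtension l ∧
        ∀ l', P.semidirect.IsBracketExtension l' → l' = l) ∧
      -- `G_∞(G ⋉ M)` with `m + l` is a complex, with components `C_N(G ⋉ M)`
      (∀ z ∈ P.semidirect.gInf, (m + l) z ∈ P.semidirect.gInf) ∧
      (m + l) ∘ₗ (m + l) = 0 ∧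
      (∀ N, ∀ z ∈ P.semidirect.chains (N + 1), (m + l) z ∈ P.semidirect.chains N) ∧
      -- the `C_N(G, M)` form a subcomplex
      (∀ N, P.moduleChains N ≤ P.semidirect.chains (N + 1)) ∧
      (∀ N, ∀ z ∈ P.moduleChains (N + 1), (m + l) z ∈ P.moduleChains N) ∧
      (∀ z ∈ P.moduleChains 0, (m + l) z = 0) ∧
      -- explicit form of the boundary on `X₁ · ⋯ · X_r · Y`
      (∀ (X : List (List (Letter A.grade))) (y : List (Letter A.grade)) (v : Letter P.grade)
        (y' : List (Letter A.grade)),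
        (m + l) (symProd (X.map P.gWord) * symProd [P.mWord y v y']) =
          (l + m) (symProd (X.map P.gWord)) * symProd [P.mWord y v y']
          + ((-1 : ℝ) ^ ((X.map P.gWord).map wordDeg).sum) •
              (symProd (X.map P.gWord) * P.semidirect.mBlock (P.mWord y v y'))
          + ∑ i : Fin X.length,
              ((-1 : ℝ) ^ (((X.eraseIdx i).map P.gWord).map wordDeg).sum *
                (-1 : ℝ) ^ (wordDeg (P.gWord (X.get i)) *
                  (((X.drop (i + 1)).map P.gWord).map wordDeg).sum)) •
                (symProd ((X.eraseIdx i).map P.gWord) *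
                  P.semidirect.lBlock (P.gWord (X.get i)) (P.mWord y v y'))) := by
  have hm := P.semidirect.isProductExtension_mulSym
  have hl := P.semidirect.isBracketExtension_lieSym
  refine ⟨P.semidirect.mulSym, P.semidirect.lieSym, ⟨hm, fun m' h => h.unique hm⟩,
    ⟨hl, fun l' h => h.unique hl⟩, fun z hz => P.semidirect.boundary_mem_gInf hz,
    P.semidirect.boundary_comp_boundary, fun N z hz => P.semidirect.boundary_mem_chains hz,
    P.moduleChains_le_chains, fun N z hz => P.boundary_mem_moduleChains hz,
    fun z hz => P.boundary_eq_zero_of_mem_moduleChains_zero hz, fun X y v y' => ?_⟩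
  rw [symProd_cons, symProd_nil, mul_one, LinearMap.add_apply, LinearMap.add_apply,
    P.semidirect.mulSym_symProd_mul_symι, P.semidirect.lieSym_symProd_map_mul_symι, add_mul]
  abel
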